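/- Notation. For $z=(x,\omega)\in\mathbb{R}^{2d}$ let $\pi(z)f(t)=e^{2\pi i\omega\cdot t}f(t-x)$ and $Pf(t)=f(-t)$ on $L^2(\mathbb{R}^d)$, and let $\Omega(z,z')=x'\cdot\omega-x\cdot\omega'$. For an operator $S$ on $L^2(\mathbb{R}^d)$ put $\alpha_z(S)=\pi(z)S\pi(z)^*$ and $\beta_w(S)=e^{-\pi i w_1\cdot w_2/2}\,\pi(\tfrac w2)\,S\,\pi(\tfrac w2)$, where $w=(w_1,w_2)\in\mathbb{R}^{2d}$. Let $M^1(\mathbb{R}^n)$ be Feichtinger's algebra (the functions, taken continuous, whose short-time Fourier transform with Gaussian window is integrable) and $M^\infty(\mathbb{R}^n)$ its (antilinear) dual. The Weyl symbol $\sigma_T$ of $T$ is determined by $\langle Tf,g\rangle=\langle\sigma_T,W(g,f)\rangle$, with the cross-Wigner distribution $W(f,g)(x,\omega)=\int_{\mathbb{R}^d} f(x+\tfrac t2)\overline{g(x-\tfrac t2)}e^{-2\pi i\omega\cdot t}\,dt$. Let $\mathcal{M}^1$ and $\mathcal{M}^\infty$ be the spaces of operators with Weyl symbol in $M^1(\mathbb{R}^{2d})$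 and $M^\infty(\mathbb{R}^{2d})$, paired by $\langle T,R\rangle=\langle\sigma_T,\sigma_R\rangle$. Theorem. Let $\Lambda=A\mathbb{Z}^{2d}$ with $A\in GL(2d,\mathbb{R})$ be a lattice, $|\Lambda|=|\det A|$, and let $\Lambda^\circ=\{z\in\mathbb{R}^{2d}: e^{2\pi i\Omega(z,\lambda)}=1\ \forall\lambda\in\Lambda\}$ be its adjoint lattice. Let $S\in\mathcal{M}^1$. Then $\sum_{\lambda^\circ\in\Lambda^\circ}|\sigma_S(\lambda^\circ)|<\infty$, and $$\sum_{\lambda\in\Lambda}\beta_\lambda(S)=\frac{2^d}{|\Lambda|}\sum_{\lambda^\circ\in\Lambda^\circ}\sigma_S(\lambda^\circ)\,e^{-4\pi i\lambda_1^\circ\cdot\lambda_2^\circ}\,\pi(2\lambda^\circ)P,$$ or equivalently $$\sum_{\lambda\in\Lambda}\beta_\lambda(S)=\frac{2^d}{|\Lambda|}\sum_{\lambda^\circ\in\Lambda^\circ}\sigma_S(\lambda^\circ)\,\alpha_{\lambda^\circ}(P).$$ Here the sums over $\Lambda^\circ$ converge absolutely in operator norm on $L^2(\mathbb{R}^d)$,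 and the sums over $\Lambda$ converge unconditionally in the weak-$*$ topology of $\mathcal{M}^\infty$ as the dual of $\mathcal{M}^1$. -/

import Mathlib

open MeasureTheory
open scoped ComplexConjugate ENNReal

noncomputable section

namespace JanssenRep

/-- The Euclidean space `ℝ^ι` (`ℝ^d` for `ι = Fin d`). -/
abbrev Vec (ι : Type) [Fintype ι] : Type := EuclideanSpace ℝ ι

/-- The phase space `ℝ^ι × ℝ^ι`; for `ι = Fin d` this is `ℝ^{2d}`. -/
abbrev Phase (ι : Type) [Fintype ι] : Type := Vec (ι ⊕ ι)

variable {ι : Type} [Fintype ι]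

/-- The position component `x` of `z = (x, ω)`. -/
def pos (z : Phase ι) : Vec ι := WithLp.toLp 2 (fun i => z (Sum.inl i))

/-- The frequency component `ω` of `z = (x, ω)`. -/
def freq (z : Phase ι) : Vec ι := WithLp.toLp 2 (fun i => z (Sum.inr i))

/-- The symplectic form `Ω(z, z') = x' · ω - x · ω'`. -/
def symp (z z' : Phase ι) : ℝ :=
  inner ℝ (pos z') (freq z) - inner ℝ (pos z) (freq z')

/-- The character `e^{2πi s}`. -/
def chr (s : ℝ) : ℂ := Complex.exp (2 * Real.pi * Complex.I * s)

/-! ### Operators on `L²(ℝ^ι)` -/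

/-- `L²(ℝ^ι)`. -/
abbrev L2 (ι : Type) [Fintype ι] : Type := Lp ℂ 2 (volume : Measure (Vec ι))

lemma norm_chr (s : ℝ) : ‖chr s‖ = 1 := by
  unfold chr
  rw [show (2 * Real.pi * Complex.I * s : ℂ) = ((2 * Real.pi * s : ℝ) : ℂ) * Complex.I by
    push_cast; ring]
  exact Complex.norm_exp_ofReal_mul_I _

lemma continuous_chr : Continuous chr := by
  unfold chr
  fun_prop

lemma memLp_modulate (w : Vec ι) {f : Vec ι → ℂ} (hf : MemLp f 2 volume) :
    MemLp (fun t => chr (inner ℝ w t) * f t) 2 volume := by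
  refine hf.of_le (g := f) ?_ ?_
  · refine AEStronglyMeasurable.mul ?_ hf.1
    exact (continuous_chr.comp (by fun_prop : Continuous fun t : Vec ι => inner ℝ w t)
      ).aestronglyMeasurable
  · filter_upwards with t
    simp [norm_chr]

/-- The modulation operator `M_ω f(t) = e^{2πi ω·t} f(t)` on `L²`. -/
def modulate (w : Vec ι) : L2 ι →L[ℂ] L2 ι :=
  LinearMap.mkContinuous
    { toFun := fun f => (memLp_modulate w (Lp.memLp f)).toLp
      map_add' := by
        intro f g
        rw [← MemLp.toLp_add, MemLp.toLp_eq_toLp_iff]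
        filter_upwards [Lp.coeFn_add f g] with t ht
        simp only [Pi.add_apply] at ht ⊢
        rw [ht, mul_add]
      map_smul' := by
        intro c f
        rw [RingHom.id_apply, ← MemLp.toLp_const_smul, MemLp.toLp_eq_toLp_iff]
        filter_upwards [Lp.coeFn_smul c f] with t ht
        simp only [ht, Pi.smul_apply, smul_eq_mul]
        ring }
    1 (by
      intro f
      rw [one_mul]
      refine Lp.norm_le_norm_of_ae_le ?_
      filter_upwards [MemLp.coeFn_toLp (memLp_modulate w (Lp.memLp f))] with t ht
      simp only [LinearMap.coe_mk, AddHom.coe_mk]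
      rw [ht]
      simp [norm_chr])

/-- The translation operator `T_x f(t) = f(t - x)` on `L²`. -/
def translate (x : Vec ι) : L2 ι →L[ℂ] L2 ι :=
  (Lp.compMeasurePreservingₗᵢ ℂ (fun t : Vec ι => t - x)
    (measurePreserving_sub_right volume x)).toContinuousLinearMap

/-- The parity operator `P f(t) = f(-t)` on `L²`. -/
def parity (ι : Type) [Fintype ι] : L2 ι →L[ℂ] L2 ι :=
  (Lp.compMeasurePreservingₗᵢ ℂ (fun t : Vec ι => -t)
    (Measure.measurePreserving_neg volume)).toContinuousLinearMap

/-- The time-frequency shift `π(z) = M_ω T_x`, `z = (x, ω)`. -/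
def tfShift (z : Phase ι) : L2 ι →L[ℂ] L2 ι := modulate (freq z) ∘L translate (pos z)

/-- The operator translation `α_z(S) = π(z) S π(z)^*`. -/
def opTranslate (z : Phase ι) (S : L2 ι →L[ℂ] L2 ι) : L2 ι →L[ℂ] L2 ι :=
  tfShift z ∘L S ∘L ContinuousLinearMap.adjoint (tfShift z)

/-- The operator modulation `β_w(S) = e^{-πi w₁·w₂/2} π(w/2) S π(w/2)`. -/
def opModulate (w : Phase ι) (S : L2 ι →L[ℂ] L2 ι) : L2 ι →L[ℂ] L2 ι :=
  Complex.exp (-(Real.pi * Complex.I * (inner ℝ (pos w) (freq w) : ℝ) / 2)) •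
    (tfShift ((1 / 2 : ℝ) • w) ∘L S ∘L tfShift ((1 / 2 : ℝ) • w))

/-! ### The modulation spaces `M¹` and `M^∞` -/

/-- The `L²`-normalised Gaussian `2^{n/4} e^{-π|t|²}` on `ℝ^ι`, `n = |ι|`. -/
def gauss (t : Vec ι) : ℂ :=
  (((2 : ℝ) ^ ((Fintype.card ι : ℝ) / 4) * Real.exp (-Real.pi * ‖t‖ ^ 2) : ℝ) : ℂ)

/-- The short-time Fourier transform
`V_g f(x, ω) = ⟨f, π(x, ω) g⟩ = ∫ f(t) conj(g(t - x)) e^{-2πi ω·t} dt`. -/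
def stft (g f : Vec ι → ℂ) (z : Phase ι) : ℂ :=
  ∫ t : Vec ι, f t * conj (chr (inner ℝ (freq z) t) * g (t - pos z))

lemma memLp_gauss : MemLp (gauss : Vec ι → ℂ) 2 volume := by
  have hc : Continuous (gauss : Vec ι → ℂ) := by unfold gauss; fun_prop
  rw [memLp_two_iff_integrable_sq_norm hc.aestronglyMeasurable]
  have h := (GaussianFourier.integrable_cexp_neg_mul_sq_norm_add (V := Vec ι)
    (b := ((2 * Real.pi : ℝ) : ℂ)) (by simpa using Real.pi_pos) 0 0).norm
  refine (h.const_mul (((2 : ℝ) ^ ((Fintype.card ι : ℝ) / 4)) ^ 2)).congr ?_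
  filter_upwards with t
  have h2 : (0 : ℝ) ≤ 2 ^ ((Fintype.card ι : ℝ) / 4) := by positivity
  unfold gauss
  rw [Complex.norm_real, Real.norm_eq_abs, sq_abs, mul_pow, ← Real.exp_nat_mul, Complex.norm_exp]
  congr 2
  simp [← Complex.ofReal_pow]
  ring

lemma integrable_stft_integrand {f : Vec ι → ℂ} (hf : MemLp f 2 volume) (z : Phase ι) :
    Integrable (fun t => f t * conj (chr (inner ℝ (freq z) t) * gauss (t - pos z))) volume := by
  have h1 : MemLp (fun t : Vec ι => gauss (t - pos z)) 2 volume :=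
    memLp_gauss.comp_measurePreserving (measurePreserving_sub_right volume (pos z))
  exact hf.integrable_mul (memLp_modulate (freq z) h1).star

/-- Feichtinger's algebra `M¹(ℝ^ι)`: the `f ∈ L²` with `V_φ f ∈ L¹`, where `φ` is the normalised
Gaussian. Each such `f` has exactly one continuous representative, and it is this representative
that is meant by an element of `M¹`. -/
def M1 (ι : Type) [Fintype ι] : Submodule ℂ (Vec ι → ℂ) where
  carrier := {f | Continuous f ∧ MemLp f 2 volume ∧ Integrable (stft gauss f) volume}
  zero_mem' := by
    refine ⟨continuous_const, MemLp.zero, ?_⟩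
    have : stft gauss (0 : Vec ι → ℂ) = 0 := by
      funext z
      simp [stft]
    rw [this]
    exact integrable_zero _ _ _
  add_mem' := by
    rintro f g ⟨hf, hf2, hf1⟩ ⟨hg, hg2, hg1⟩
    refine ⟨hf.add hg, hf2.add hg2, ?_⟩
    have : stft gauss (f + g) = stft gauss f + stft gauss g := by
      funext z
      simp only [stft, Pi.add_apply, add_mul]
      exact integral_add (integrable_stft_integrand hf2 z) (integrable_stft_integrand hg2 z)
    rw [this]
    exact hf1.add hg1
  smul_mem' := by
    rintro c f ⟨hf, hf2, hf1⟩
    refine ⟨hf.const_smul c, hf2.const_smul c, ?_⟩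
    have : stft gauss (c • f) = c • stft gauss f := by
      funext z
      simp only [stft, Pi.smul_apply, smul_eq_mul, mul_assoc]
      exact integral_const_mul _ _
    rw [this]
    exact hf1.smul c

/-- The norm `‖f‖_{M¹} = ‖V_φ f‖_{L¹}`. -/
def M1norm (f : M1 ι) : ℝ := ∫ z : Phase ι, ‖stft gauss (f : Vec ι → ℂ) z‖

/-- `M^∞(ℝ^ι)`, the dual of `M¹(ℝ^ι)`: the bounded antilinear functionals on `M¹(ℝ^ι)`. -/
def MInfty (ι : Type) [Fintype ι] : Type :=
  {u : M1 ι →ₛₗ[starRingEnd ℂ] ℂ // ∃ C : ℝ, ∀ f : M1 ι, ‖u f‖ ≤ C * M1norm f}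

/-! ### Weyl symbols -/

/-- The cross-Wigner distribution
`W(f, g)(x, ω) = ∫ f(x + t/2) conj(g(x - t/2)) e^{-2πi ω·t} dt`. -/
def wigner (f g : Vec ι → ℂ) (z : Phase ι) : ℂ :=
  ∫ t : Vec ι, f (pos z + (1 / 2 : ℝ) • t) * conj (g (pos z - (1 / 2 : ℝ) • t)) *
    chr (-inner ℝ (freq z) t)

/-- `⟨S f, g⟩` for Schwartz functions `f`, `g`, linear in `f` and antilinear in `g`. -/
def matrixCoeff (S : L2 ι →L[ℂ] L2 ι) (f g : SchwartzMap (Vec ι) ℂ) : ℂ :=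
  inner ℂ (g.toLp 2 volume : L2 ι) (S (f.toLp 2 volume))

/-- The function `σ ∈ M¹(ℝ^{2d})` is the Weyl symbol of `S`: `⟨S f, g⟩ = ⟨σ, W(g, f)⟩` for all
Schwartz functions `f`, `g`. The operators that have such a symbol form the class `𝓜¹`. -/
def HasWeylSymbolM1 (S : L2 ι →L[ℂ] L2 ι) (σ : M1 (ι ⊕ ι)) : Prop :=
  ∀ f g : SchwartzMap (Vec ι) ℂ,
    matrixCoeff S f g = ∫ z : Phase ι, (σ : Phase ι → ℂ) z * conj (wigner g f z)

/-- The distribution `u ∈ M^∞(ℝ^{2d})` is the Weyl symbol of `T`: `⟨T f, g⟩ = ⟨u, W(g, f)⟩` for all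
Schwartz functions `f`, `g`. (Here `W(g, f)` is always an element of `M¹(ℝ^{2d})`.) -/
def HasWeylSymbol (T : L2 ι →L[ℂ] L2 ι) (u : MInfty (ι ⊕ ι)) : Prop :=
  ∀ f g : SchwartzMap (Vec ι) ℂ, ∀ τ : M1 (ι ⊕ ι), (τ : Phase ι → ℂ) = wigner g f →
    matrixCoeff T f g = u.1 τ

/-- `∑ k, T k = T₀` unconditionally in the weak-* topology of `𝓜^∞`, the dual of `𝓜¹` under the
bracket `⟨T, R⟩ = ⟨σ_T, σ_R⟩`; as `R` runs through `𝓜¹`, its symbol `τ = σ_R` runs through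
`M¹(ℝ^{2d})`. -/
def WeakStarHasSum {κ : Type} (T : κ → (L2 ι →L[ℂ] L2 ι)) (T₀ : L2 ι →L[ℂ] L2 ι) : Prop :=
  ∃ (u : κ → MInfty (ι ⊕ ι)) (u₀ : MInfty (ι ⊕ ι)),
    (∀ k, HasWeylSymbol (T k) (u k)) ∧ HasWeylSymbol T₀ u₀ ∧
      ∀ τ : M1 (ι ⊕ ι), HasSum (fun k => (u k).1 τ) (u₀.1 τ)

/-! ### Lattices -/

/-- The lattice `Λ = A ℤ^{2d}`. -/
def lattice [DecidableEq ι] (A : Matrix.GeneralLinearGroup (ι ⊕ ι) ℝ) : Set (Phase ι) :=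
  Set.range fun n : ι ⊕ ι → ℤ =>
    (WithLp.toLp 2 (Matrix.mulVec (A : Matrix (ι ⊕ ι) (ι ⊕ ι) ℝ) (fun i => (n i : ℝ))) : Phase ι)

/-- The lattice volume `|Λ| = |det A|`. -/
def latticeVol [DecidableEq ι] (A : Matrix.GeneralLinearGroup (ι ⊕ ι) ℝ) : ℝ :=
  |(A : Matrix (ι ⊕ ι) (ι ⊕ ι) ℝ).det|

/-- The adjoint lattice `Λ° = {z : e^{2πi Ω(z, λ)} = 1 for all λ ∈ Λ}`. -/
def adjointLattice (L : Set (Phase ι)) : Set (Phase ι) :=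
  {z | ∀ l ∈ L, chr (symp z l) = 1}

end JanssenRep

end

noncomputable section

namespace JanssenRep

/-! On the level of Weyl symbols the theorem is a Poisson summation formula. Operator modulation
multiplies the symbol by a symplectic character: the symbol of `β_λ(S)` is `σ(z) e^{2πiΩ(λ,z)}`
(`conj_wigner_shift`). On the other side, the symbol of `α_z(P)` is `2^{-d}` times the point mass at
`z` (`matrixCoeff_tfShift_parity`). Tested against `τ ∈ M¹`, the claim therefore says that the
symplectic Fourier coefficients of `σ · conj τ` over `Λ` sum to `|Λ|⁻¹` times the sum of the samples
of `σ · conj τ` over `Λ°` (`hasSum_lattice_integral`). The factors `2^d` and `2^{-d}` cancel.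

Since `Ω(z, λ)` is the Euclidean product of `z` with `Jλ`, the lattice `Λ°` is the ordinary dual of
`JΛ`, and a linear change of variables reduces everything to `ℤ^{2d}`.

The analysis lies in the absolute summability of both sides. Each `f ∈ M¹` is a superposition of
time-frequency shifts of the Gaussian with the integrable density `V_φ f` (`M1.inversion`). Gaussian
sums over a translated lattice are bounded uniformly in the translation
(`exists_sum_exp_lattice_le`). Together these make the local suprema of `f` over lattice cells
summable (`M1.exists_summable_bound`), which handles the samples. The Fourier coefficients of `σ ·
conj τ` are bounded by a correlation of the two short-time Fourier transforms, and the reproducing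
estimate `M1.norm_stft_le` makes these summable. It is thus not necessary to know that the product
lies in `M¹`. -/

/-! ### Poisson summation on `ℝ^κ` -/

section Poisson

set_option linter.unusedSectionVars false

variable {κ : Type} [Fintype κ]

/-- The integer vector `n` as a real vector. -/
def intVec (n : κ → ℤ) : κ → ℝ := fun i => n i

/-- The half-open unit box with lower corner `a`. -/
def unitBox (a : κ → ℝ) : Set (κ → ℝ) := {x | ∀ i, x i ∈ Set.Ioc (a i) (a i + 1)}

lemma measurableSet_unitBox (a : κ → ℝ) : MeasurableSet (unitBox a) :=
  MeasurableSet.univ_pi' fun _ => measurableSet_Ioc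

lemma pairwise_disjoint_unitBox :
    Pairwise (Function.onFun Disjoint fun n : κ → ℤ => unitBox (intVec n)) := by
  intro m n hmn
  refine Set.disjoint_left.2 fun x hx hy => hmn (funext fun i => ?_)
  have h1 := hx i
  have h2 := hy i
  simp only [intVec, Set.mem_Ioc] at h1 h2
  have h3 : (m i : ℝ) < (n i + 1 : ℤ) := by push_cast; linarith
  have h4 : (n i : ℝ) < (m i + 1 : ℤ) := by push_cast; linarith
  have h5 := Int.cast_lt.1 h3
  have h6 := Int.cast_lt.1 h4
  omega

lemma iUnion_unitBox : ⋃ n : κ → ℤ, unitBox (intVec n) = Set.univ := by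
  -- The boxes are open at the lower end, so an integer coordinate belongs to the box below it;
  -- hence `⌈x⌉ - 1` and not `⌊x⌋`.
  refine Set.eq_univ_of_forall fun x => Set.mem_iUnion.2 ⟨fun i => ⌈x i⌉ - 1, fun i => ?_⟩
  simp only [intVec, Set.mem_Ioc]
  push_cast
  constructor
  · linarith [Int.ceil_lt_add_one (x i)]
  · linarith [Int.le_ceil (x i)]

lemma hasSum_integral_unitBox {f : (κ → ℝ) → ℂ} (hf : Integrable f) :
    HasSum (fun n : κ → ℤ => ∫ y in unitBox 0, f (y + intVec n)) (∫ y, f y) := by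
  have h := hasSum_integral_iUnion (μ := volume) (f := f)
    (fun n : κ → ℤ => measurableSet_unitBox (intVec n)) pairwise_disjoint_unitBox hf.integrableOn
  rw [iUnion_unitBox, setIntegral_univ] at h
  convert! h using 2 with n
  have hpre : (fun y : κ → ℝ => y + intVec n) ⁻¹' unitBox (intVec n) = unitBox 0 := by
    ext y
    simp only [unitBox, Set.mem_preimage, Set.mem_ofPred_eq, Set.mem_Ioc, Pi.add_apply,
      Pi.zero_apply]
    refine forall_congr' fun i => ?_
    constructor <;> rintro ⟨h1, h2⟩ <;> constructor <;> linarith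
  rw [← hpre]
  exact (measurePreserving_add_right volume (intVec n)).setIntegral_preimage_emb
    (measurableEmbedding_addRight (intVec n)) f _

lemma chr_add (s t : ℝ) : chr (s + t) = chr s * chr t := by
  simp only [chr]
  rw [← Complex.exp_add]
  push_cast
  ring_nf

lemma chr_int (n : ℤ) : chr n = 1 := by
  rw [chr, Complex.exp_eq_one_iff]
  exact ⟨n, by push_cast; ring⟩

lemma chr_zero : chr 0 = 1 := by simp [chr]

lemma conj_chr (s : ℝ) : conj (chr s) = chr (-s) := by
  simp only [chr, ← Complex.exp_conj]
  simp [Complex.conj_ofNat]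

lemma chr_sum (s : κ → ℝ) : chr (∑ i, s i) = ∏ i, chr (s i) := by
  simp only [chr, ← Complex.exp_sum]
  congr 1
  push_cast
  rw [Finset.mul_sum]

lemma mFourier_coe (n : κ → ℤ) (y : κ → ℝ) :
    UnitAddTorus.mFourier n (fun i => (y i : UnitAddCircle)) = chr (∑ i, n i * y i) := by
  rw [chr_sum]
  simp only [UnitAddTorus.mFourier, ContinuousMap.coe_mk]
  refine Finset.prod_congr rfl fun i _ => ?_
  rw [fourier_coe_apply, chr]
  congr 1
  push_cast
  ring

lemma isOpenQuotientMap_torus :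
    IsOpenQuotientMap (fun (y : κ → ℝ) i => (y i : UnitAddCircle)) :=
  IsOpenQuotientMap.piMap (f := fun (_ : κ) (x : ℝ) => (x : UnitAddCircle))
    fun _ => QuotientAddGroup.isOpenQuotientMap_mk

/-- Poisson summation for functions with locally uniformly summable integer translates. -/
theorem poisson_summation {g : (κ → ℝ) → ℂ} (hc : Continuous g) (hi : Integrable g)
    (hb : ∀ c : κ → ℝ, ∃ b : (κ → ℤ) → ℝ, Summable b ∧
      ∀ n y, ‖y - c‖ ≤ 1 → ‖g (y + intVec n)‖ ≤ b n)
    (hs : Summable fun n : κ → ℤ => ∫ y, g y * chr (-∑ i, n i * y i)) :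
    ∑' n : κ → ℤ, ∫ y, g y * chr (-∑ i, n i * y i) = ∑' n : κ → ℤ, g (intVec n) := by
  set G : (κ → ℝ) → ℂ := fun y => ∑' n : κ → ℤ, g (y + intVec n) with hG
  have hGc : Continuous G := by
    rw [continuous_iff_continuousAt]
    intro c
    obtain ⟨b, hbs, hbb⟩ := hb c
    have h : ContinuousOn G (Metric.closedBall c 1) :=
      continuousOn_tsum (fun n => (hc.comp (continuous_add_const _)).continuousOn) hbs
        fun n y hy => hbb n y (by simpa [dist_eq_norm] using hy)
    exact h.continuousAt (Metric.closedBall_mem_nhds c one_pos)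
  have hper : ∀ (y : κ → ℝ) (m : κ → ℤ), G (y + intVec m) = G y := by
    intro y m
    simp only [hG]
    rw [← (Equiv.addLeft m).tsum_eq (fun n : κ → ℤ => g (y + intVec n))]
    refine tsum_congr fun n => ?_
    congr 1
    funext i
    simp [intVec, add_assoc]
  -- The periodisation `G` is constant on the fibres of `q` and descends to a continuous `F` on the
  -- torus, where Fourier series are available.
  set q : (κ → ℝ) → UnitAddTorus κ := fun y i => (y i : UnitAddCircle) with hq
  have hqo : IsOpenQuotientMap q := isOpenQuotientMap_torus
  have hfib : ∀ x y, q x = q y → G x = G y := by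
    intro x y hxy
    have : ∀ i, ∃ m : ℤ, x i = y i + m := by
      intro i
      have h : ((x i - y i : ℝ) : UnitAddCircle) = 0 := by
        rw [AddCircle.coe_sub, sub_eq_zero]
        exact congrFun hxy i
      obtain ⟨m, hm⟩ := (AddCircle.coe_eq_zero_iff 1).1 h
      refine ⟨m, ?_⟩
      rw [zsmul_one] at hm
      linarith
    choose m hm using this
    rw [← hper y m]
    congr 1
    exact funext hm
  obtain ⟨F, hF⟩ : ∃ F : C(UnitAddTorus κ, ℂ), ∀ y, F (q y) = G y := by
    have hF : ∀ y, G (Function.surjInv hqo.surjective (q y)) = G y :=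
      fun y => hfib _ _ (Function.surjInv_eq hqo.surjective (q y))
    refine ⟨⟨fun θ => G (Function.surjInv hqo.surjective θ), ?_⟩, hF⟩
    refine hqo.isQuotientMap.continuous_iff.2 ?_
    convert! hGc using 1
    exact funext hF
  have hcoef : ∀ n : κ → ℤ, UnitAddTorus.mFourierCoeff F n = ∫ y, g y * chr (-∑ i, n i * y i) := by
    intro n
    rw [UnitAddTorus.mFourierCoeff_eq_integral F n 0]
    have hcc : Continuous fun y : κ → ℝ => chr (-∑ i, n i * y i) :=
      continuous_chr.comp (by fun_prop)
    have hint : Integrable fun y => g y * chr (-∑ i, n i * y i) :=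
      hi.mul_bdd (c := 1) hcc.aestronglyMeasurable
        (Filter.Eventually.of_forall fun y => (norm_chr _).le)
    rw [← (hasSum_integral_unitBox hint).tsum_eq]
    obtain ⟨b, hbs, hbb⟩ := hb 0
    have hshift : ∀ (y : κ → ℝ) (m : κ → ℤ),
        chr (-∑ i, n i * (y + intVec m) i) = chr (-∑ i, n i * y i) := by
      intro y m
      have : -∑ i, n i * (y + intVec m) i
          = -∑ i, n i * y i + ((-∑ i, n i * m i : ℤ) : ℝ) := by
        simp only [Pi.add_apply, intVec, mul_add, Finset.sum_add_distrib]
        push_cast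
        ring
      rw [this, chr_add, chr_int, mul_one]
    -- In the sup norm the unit box lies in the unit ball about `0`, so the local bound at `0`
    -- dominates every translate on the box and sum and integral can be exchanged.
    have hbox : ∀ y ∈ unitBox (0 : κ → ℝ), ‖y - 0‖ ≤ 1 := by
      intro y hy
      rw [sub_zero, pi_norm_le_iff_of_nonneg zero_le_one]
      intro i
      have := hy i
      simp only [Pi.zero_apply, Set.mem_Ioc] at this
      rw [Real.norm_eq_abs, abs_le]
      constructor <;> linarith [this.1, this.2]
    have hfin : volume (unitBox (0 : κ → ℝ)) < ∞ :=
      lt_of_le_of_lt (measure_mono (t := Metric.closedBall 0 1) fun y hy => by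
        simpa using hbox y hy) measure_closedBall_lt_top
    have hboxm := measurableSet_unitBox (0 : κ → ℝ)
    have hbd : ∀ m : κ → ℤ, ∀ y ∈ unitBox (0 : κ → ℝ),
        ‖g (y + intVec m) * chr (-∑ i, n i * (y + intVec m) i)‖ ≤ b m := by
      intro m y hy
      rw [norm_mul, norm_chr, mul_one]
      exact hbb m y (hbox y hy)
    have hint_box : ∀ m : κ → ℤ, IntegrableOn
        (fun y => g (y + intVec m) * chr (-∑ i, n i * (y + intVec m) i)) (unitBox 0) :=
      fun m => (hint.comp_add_right (intVec m)).integrableOn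
    have hsw :=
      integral_tsum_of_summable_integral_norm (μ := volume.restrict (unitBox 0)) hint_box ?_
    · rw [hsw]
      refine setIntegral_congr_fun hboxm fun y _ => ?_
      change UnitAddTorus.mFourier (-n) (q y) • F (q y) = _
      rw [hF, hq, mFourier_coe]
      simp only [hshift, hG]
      rw [tsum_mul_right, smul_eq_mul, mul_comm]
      simp
    · refine Summable.of_nonneg_of_le (fun m => integral_nonneg fun y => norm_nonneg _)
        (fun m => ?_) (hbs.mul_right (volume.real (unitBox (0 : κ → ℝ))))
      have h1 : IntegrableOn (fun _ : κ → ℝ => b m) (unitBox 0) volume :=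
        integrableOn_const hfin.ne
      have h2 := setIntegral_mono_on (Integrable.norm (hint_box m)) h1 hboxm (hbd m)
      rwa [setIntegral_const, smul_eq_mul, mul_comm] at h2
  have hsF : Summable (UnitAddTorus.mFourierCoeff F) := by
    have h : UnitAddTorus.mFourierCoeff F = fun n => ∫ y, g y * chr (-∑ i, n i * y i) :=
      funext hcoef
    rw [h]
    exact hs
  -- Summable coefficients make the Fourier series of `F` converge to it pointwise; at `0` all
  -- characters equal 1.
  have h0 := UnitAddTorus.hasSum_mFourier_series_apply_of_summable hsF (q 0)
  rw [hF 0] at h0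
  have h1 : ∀ n : κ → ℤ, UnitAddTorus.mFourierCoeff F n • UnitAddTorus.mFourier n (q 0)
      = ∫ y, g y * chr (-∑ i, n i * y i) := by
    intro n
    rw [hcoef, hq, mFourier_coe]
    simp [chr_zero]
  simp only [h1] at h0
  rw [h0.tsum_eq, hG]
  simp

end Poisson

section PhaseSpace

variable {ι : Type} [Fintype ι]

/-! ### Phase space as a product -/

/-- Phase space as the product of position and frequency space. -/
def phaseEquiv (ι : Type) [Fintype ι] : Phase ι ≃ᵐ Vec ι × Vec ι :=
  (MeasurableEquiv.toLp 2 _).symm.trans <|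
    (MeasurableEquiv.sumPiEquivProdPi (fun _ => ℝ)).trans <|
      MeasurableEquiv.prodCongr (MeasurableEquiv.toLp 2 _) (MeasurableEquiv.toLp 2 _)

lemma phaseEquiv_apply (z : Phase ι) : phaseEquiv ι z = (pos z, freq z) := rfl

lemma measurePreserving_phaseEquiv : MeasurePreserving (phaseEquiv ι) := by
  refine (EuclideanSpace.volume_preserving_symm_measurableEquiv_toLp _).trans ?_
  refine (volume_measurePreserving_sumPiEquivProdPi _).trans ?_
  refine MeasurePreserving.prod ?_ ?_
  all_goals exact (EuclideanSpace.volume_preserving_symm_measurableEquiv_toLp _).symm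

/-- The phase space point `(x, ω)`. -/
def phasePt (x w : Vec ι) : Phase ι := WithLp.toLp 2 (Sum.elim x w)

@[simp] lemma pos_phasePt (x w : Vec ι) : pos (phasePt x w) = x := rfl

@[simp] lemma freq_phasePt (x w : Vec ι) : freq (phasePt x w) = w := rfl

lemma phaseEquiv_symm_apply (p : Vec ι × Vec ι) : (phaseEquiv ι).symm p = phasePt p.1 p.2 := by
  rw [MeasurableEquiv.symm_apply_eq]
  rfl

@[fun_prop] lemma continuous_pos : Continuous (pos : Phase ι → Vec ι) := by
  unfold pos
  fun_prop

@[fun_prop] lemma continuous_freq : Continuous (freq : Phase ι → Vec ι) := by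
  unfold freq
  fun_prop

lemma integral_phase (F : Phase ι → ℂ) :
    ∫ z, F z = ∫ p : Vec ι × Vec ι, F (phasePt p.1 p.2) := by
  rw [← measurePreserving_phaseEquiv.integral_comp (phaseEquiv ι).measurableEmbedding]
  refine integral_congr_ae (Filter.Eventually.of_forall fun z => ?_)
  change F z = F (phasePt (pos z) (freq z))
  rw [← phaseEquiv_symm_apply (pos z, freq z), ← phaseEquiv_apply, MeasurableEquiv.symm_apply_apply]

lemma integrable_phase {F : Phase ι → ℂ} (hF : Integrable F) :
    Integrable (fun p : Vec ι × Vec ι => F (phasePt p.1 p.2)) := by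
  have h := (measurePreserving_phaseEquiv (ι := ι)).symm.integrable_comp_of_integrable hF
  convert! h using 1

/-! ### The Gaussian -/

/-- The normalised Gaussian as a real function. -/
def gaussR (t : Vec ι) : ℝ := 2 ^ ((Fintype.card ι : ℝ) / 4) * Real.exp (-Real.pi * ‖t‖ ^ 2)

lemma gauss_eq (t : Vec ι) : gauss t = (gaussR t : ℂ) := rfl

lemma gaussR_nonneg (t : Vec ι) : 0 ≤ gaussR t := by unfold gaussR; positivity

lemma norm_gauss (t : Vec ι) : ‖(gauss t : ℂ)‖ = gaussR t := by
  rw [gauss_eq, Complex.norm_real, Real.norm_of_nonneg (gaussR_nonneg t)]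

/-- The maximum of the normalised Gaussian. -/
def gaussMax (ι : Type) [Fintype ι] : ℝ := 2 ^ ((Fintype.card ι : ℝ) / 4)

lemma gaussR_le (t : Vec ι) : gaussR t ≤ gaussMax ι := by
  unfold gaussR gaussMax
  refine mul_le_of_le_one_right (by positivity) (Real.exp_le_one_iff.2 ?_)
  have := mul_nonneg Real.pi_pos.le (sq_nonneg ‖t‖)
  linarith

@[fun_prop] lemma continuous_gaussR : Continuous (gaussR : Vec ι → ℝ) := by
  unfold gaussR; fun_prop

@[fun_prop] lemma continuous_gauss : Continuous (gauss : Vec ι → ℂ) :=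
  Complex.continuous_ofReal.comp continuous_gaussR

lemma integrable_gaussR : Integrable (gaussR : Vec ι → ℝ) := by
  have h := (GaussianFourier.integrable_cexp_neg_mul_sq_norm_add (V := Vec ι)
    (b := ((Real.pi : ℝ) : ℂ)) (by simpa using Real.pi_pos) 0 0).norm
  refine (h.const_mul (2 ^ ((Fintype.card ι : ℝ) / 4))).congr ?_
  filter_upwards with t
  unfold gaussR
  rw [Complex.norm_exp]
  congr 2
  simp [← Complex.ofReal_pow]

/-- With the origin moved to the midpoint of `x` and `y`, the parallelogram law removes the mixed
term and the product separates into a factor in `x - y` and a Gaussian in `t`. -/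
lemma gaussR_mul_gaussR (t x y : Vec ι) :
    gaussR (t + (1 / 2 : ℝ) • (x + y) - x) * gaussR (t + (1 / 2 : ℝ) • (x + y) - y) =
      2 ^ ((Fintype.card ι : ℝ) / 2) * Real.exp (-(Real.pi / 2) * ‖x - y‖ ^ 2) *
        Real.exp (-(2 * Real.pi) * ‖t‖ ^ 2) := by
  unfold gaussR
  have e1 : t + (1 / 2 : ℝ) • (x + y) - x = t - (1 / 2 : ℝ) • (x - y) := by module
  have e2 : t + (1 / 2 : ℝ) • (x + y) - y = t + (1 / 2 : ℝ) • (x - y) := by module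
  have e3 : (2 : ℝ) ^ ((Fintype.card ι : ℝ) / 2)
      = 2 ^ ((Fintype.card ι : ℝ) / 4) * 2 ^ ((Fintype.card ι : ℝ) / 4) := by
    rw [← Real.rpow_add two_pos]
    congr 1
    ring
  have e4 : Real.exp (-Real.pi * ‖t - (1 / 2 : ℝ) • (x - y)‖ ^ 2) *
      Real.exp (-Real.pi * ‖t + (1 / 2 : ℝ) • (x - y)‖ ^ 2) =
      Real.exp (-(Real.pi / 2) * ‖x - y‖ ^ 2) * Real.exp (-(2 * Real.pi) * ‖t‖ ^ 2) := by
    rw [← Real.exp_add, ← Real.exp_add]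
    congr 1
    have h := parallelogram_law_with_norm ℝ t ((1 / 2 : ℝ) • (x - y))
    have h2 : ‖(1 / 2 : ℝ) • (x - y)‖ = 1 / 2 * ‖x - y‖ := by
      rw [norm_smul]; norm_num
    rw [h2] at h
    linear_combination (-Real.pi) * h
  rw [e1, e2, e3]
  linear_combination (2 ^ ((Fintype.card ι : ℝ) / 4) * 2 ^ ((Fintype.card ι : ℝ) / 4)) * e4

/-- The ambiguity function of the Gaussian decays like a Gaussian. -/
lemma integral_chr_gaussR_mul (w x y : Vec ι) :
    ∃ c : ℂ, ‖c‖ = 1 ∧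
      ∫ t : Vec ι, chr (inner ℝ w t) * ((gaussR (t - x) * gaussR (t - y) : ℝ) : ℂ) =
        c * (Real.exp (-(Real.pi / 2) * (‖x - y‖ ^ 2 + ‖w‖ ^ 2)) : ℝ) := by
  refine ⟨chr (inner ℝ w ((1 / 2 : ℝ) • (x + y))), norm_chr _, ?_⟩
  rw [← integral_add_right_eq_self _ ((1 / 2 : ℝ) • (x + y))]
  simp only [gaussR_mul_gaussR, inner_add_right, chr_add]
  have h := GaussianFourier.integral_cexp_neg_mul_sq_norm_add (V := Vec ι)
    (b := ((2 * Real.pi : ℝ) : ℂ)) (by simpa using Real.pi_pos) (2 * Real.pi * Complex.I) w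
  -- The constant `2^{-n/2}` of the Gaussian integral cancels the squared normalisation `2^{n/2}`.
  have hk : ((Real.pi : ℂ) / ((2 * Real.pi : ℝ) : ℂ)) ^
      ((Module.finrank ℝ (Vec ι) : ℂ) / 2) =
      (((2 : ℝ) ^ ((Fintype.card ι : ℝ) / 2))⁻¹ : ℝ) := by
    have : (Real.pi : ℂ) / ((2 * Real.pi : ℝ) : ℂ) = ((1 / 2 : ℝ) : ℂ) := by
      push_cast
      field_simp [Complex.ofReal_ne_zero.2 Real.pi_ne_zero]
    rw [this, finrank_euclideanSpace, one_div, ← Real.inv_rpow two_pos.le,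
      Complex.ofReal_cpow (by norm_num)]
    push_cast
    rfl
  have he : (2 * (Real.pi : ℂ) * Complex.I) ^ 2 * (‖w‖ : ℂ) ^ 2 / (4 * ((2 * Real.pi : ℝ) : ℂ)) =
      ((-(Real.pi / 2) * ‖w‖ ^ 2 : ℝ) : ℂ) := by
    have := Complex.ofReal_ne_zero.2 Real.pi_ne_zero
    push_cast
    field_simp
    rw [Complex.I_sq]
    ring
  rw [hk, he, ← Complex.ofReal_exp] at h
  have e : ∀ t : Vec ι, chr (inner ℝ w t) * chr (inner ℝ w ((1 / 2 : ℝ) • (x + y))) *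
      ((2 ^ ((Fintype.card ι : ℝ) / 2) * Real.exp (-(Real.pi / 2) * ‖x - y‖ ^ 2) *
        Real.exp (-(2 * Real.pi) * ‖t‖ ^ 2) : ℝ) : ℂ) =
      chr (inner ℝ w ((1 / 2 : ℝ) • (x + y))) *
        ((2 ^ ((Fintype.card ι : ℝ) / 2) * Real.exp (-(Real.pi / 2) * ‖x - y‖ ^ 2) : ℝ) : ℂ) *
      Complex.exp (-((2 * Real.pi : ℝ) : ℂ) * (‖t‖ : ℂ) ^ 2 +
        2 * Real.pi * Complex.I * (inner ℝ w t : ℝ)) := by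
    intro t
    rw [Complex.exp_add]
    change _ = _ * (_ * chr (inner ℝ w t))
    push_cast
    ring
  simp only [e]
  rw [integral_const_mul, h, mul_add, Real.exp_add]
  have hp : ((2 : ℝ) ^ ((Fintype.card ι : ℝ) / 2)) ≠ 0 := by positivity
  rw [mul_assoc]
  congr 1
  rw [← Complex.ofReal_mul, ← Complex.ofReal_mul]
  congr 1
  field_simp

/-- Only the decay in frequency is kept, because the sums over Fourier coefficients below shift the
frequency variable alone. -/
lemma norm_integral_chr_gaussR_mul_le (w x y : Vec ι) :
    ‖∫ t : Vec ι, chr (inner ℝ w t) * ((gaussR (t - x) * gaussR (t - y) : ℝ) : ℂ)‖ ≤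
      Real.exp (-(Real.pi / 2) * ‖w‖ ^ 2) := by
  obtain ⟨c, hc, h⟩ := integral_chr_gaussR_mul w x y
  rw [h, norm_mul, hc, one_mul, Complex.norm_real, Real.norm_of_nonneg (Real.exp_pos _).le,
    Real.exp_le_exp]
  have := mul_nonneg (by positivity : 0 ≤ Real.pi / 2) (sq_nonneg ‖x - y‖)
  linarith

/-- The ambiguity function at the origin is known only up to a unimodular factor; positivity of the
integrand forces the value 1. -/
lemma integral_gaussR_sq (t : Vec ι) :
    ∫ x : Vec ι, ((gaussR (t - x) * gaussR (t - x) : ℝ) : ℂ) = 1 := by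
  obtain ⟨c, hc, h⟩ := integral_chr_gaussR_mul (0 : Vec ι) 0 0
  rw [integral_sub_left_eq_self (fun x : Vec ι => ((gaussR x * gaussR x : ℝ) : ℂ)) volume t]
  simp only [inner_zero_left, chr_zero, one_mul, sub_zero] at h
  have hc1 : ‖∫ t : Vec ι, ((gaussR t * gaussR t : ℝ) : ℂ)‖ = 1 := by
    rw [h]
    simp [hc]
  rw [integral_complex_ofReal] at hc1 ⊢
  rw [Complex.norm_real, Real.norm_of_nonneg
    (integral_nonneg fun x => mul_nonneg (gaussR_nonneg x) (gaussR_nonneg x))] at hc1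
  rw [hc1]
  simp

end PhaseSpace

section Reconstruction

variable {ι : Type} [Fintype ι]

/-! ### Reconstruction from the short-time Fourier transform -/

lemma stft_gauss_eq (f : Vec ι → ℂ) (z : Phase ι) :
    stft gauss f z = ∫ t, f t * (chr (-inner ℝ (freq z) t) * gauss (t - pos z)) := by
  unfold stft
  simp only [map_mul, conj_chr, gauss_eq, Complex.conj_ofReal]

lemma integrable_mul_gauss {f : Vec ι → ℂ} (hf : MemLp f 2 volume) (x : Vec ι) :
    Integrable (fun t => f t * gauss (t - x)) :=
  hf.integrable_mul (memLp_gauss.comp_measurePreserving (measurePreserving_sub_right volume x))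

/-- For a fixed position this makes Fourier inversion in the frequency variable applicable. -/
lemma fourier_mul_gauss (f : Vec ι → ℂ) (x w : Vec ι) :
    FourierTransform.fourier (fun t => f t * gauss (t - x)) w = stft gauss f (phasePt x w) := by
  rw [Real.fourier_eq', stft_gauss_eq]
  refine integral_congr_ae (Filter.Eventually.of_forall fun t => ?_)
  simp only [pos_phasePt, freq_phasePt, smul_eq_mul, chr]
  rw [real_inner_comm]
  push_cast
  ring_nf

lemma M1.continuous (f : M1 ι) : Continuous (f : Vec ι → ℂ) := f.2.1

lemma M1.memLp (f : M1 ι) : MemLp (f : Vec ι → ℂ) 2 volume := f.2.2.1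

lemma M1.integrable_stft (f : M1 ι) : Integrable (stft gauss (f : Vec ι → ℂ)) := f.2.2.2

/-- Fubini makes the transform integrable in frequency for almost every `x`. For such `x`,
continuity of `f` gives Fourier inversion at every `t`, so the exceptional null set does not depend
on `t`. -/
lemma ae_mul_gauss_eq (f : M1 ι) : ∀ᵐ x : Vec ι, ∀ t : Vec ι,
    ∫ w, stft gauss (f : Vec ι → ℂ) (phasePt x w) * chr (inner ℝ w t) =
      (f : Vec ι → ℂ) t * gauss (t - x) := by
  have hprod := integrable_phase (M1.integrable_stft f)
  filter_upwards [hprod.prod_right_ae] with x hx t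
  have hfour : FourierTransform.fourier (fun t => (f : Vec ι → ℂ) t * gauss (t - x)) =
      fun w => stft gauss (f : Vec ι → ℂ) (phasePt x w) := funext fun w => fourier_mul_gauss _ x w
  have hc : Continuous fun t => (f : Vec ι → ℂ) t * gauss (t - x) :=
    (M1.continuous f).mul (continuous_gauss.comp (continuous_id.sub continuous_const))
  have h := congrFun (hc.fourierInv_fourier_eq (integrable_mul_gauss (M1.memLp f) x)
    (by rw [hfour]; exact hx)) t
  rw [hfour, Real.fourierInv_eq'] at h
  rw [← h]
  refine integral_congr_ae (Filter.Eventually.of_forall fun w => ?_)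
  simp only [smul_eq_mul, chr]
  push_cast
  ring_nf

lemma integrable_stft_mul (f : M1 ι) (k : Phase ι → ℂ) (hk : Continuous k) (C : ℝ)
    (hC : ∀ z, ‖k z‖ ≤ C) : Integrable fun z => stft gauss (f : Vec ι → ℂ) z * k z :=
  (M1.integrable_stft f).mul_bdd hk.aestronglyMeasurable (Filter.Eventually.of_forall hC)

lemma continuous_atom (t : Vec ι) :
    Continuous fun z : Phase ι => chr (inner ℝ (freq z) t) * gauss (t - pos z) :=
  (continuous_chr.comp (by fun_prop)).mul (by fun_prop)

lemma norm_atom (z : Phase ι) (t : Vec ι) :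
    ‖chr (inner ℝ (freq z) t) * gauss (t - pos z)‖ = gaussR (t - pos z) := by
  rw [norm_mul, norm_chr, one_mul, norm_gauss]

/-- Functions in `M¹` are superpositions of time-frequency shifts of the Gaussian. -/
lemma M1.inversion (f : M1 ι) (t : Vec ι) :
    (f : Vec ι → ℂ) t = ∫ z : Phase ι,
      stft gauss (f : Vec ι → ℂ) z * (chr (inner ℝ (freq z) t) * gauss (t - pos z)) := by
  have hint := integrable_stft_mul f _ (continuous_atom t) (gaussMax ι) fun z =>
    (norm_atom z t).le.trans (gaussR_le _)
  rw [integral_phase, Measure.volume_eq_prod, integral_prod _ (integrable_phase hint)]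
  simp only [pos_phasePt, freq_phasePt]
  -- The frequency integral returns `f(t) φ(t-x)²`; the position integral then removes the window,
  -- which has `L²` norm 1.
  have h : ∀ᵐ x : Vec ι, (∫ w, stft gauss (f : Vec ι → ℂ) (phasePt x w) *
      (chr (inner ℝ w t) * gauss (t - x))) =
      (f : Vec ι → ℂ) t * ((gaussR (t - x) * gaussR (t - x) : ℝ) : ℂ) := by
    filter_upwards [ae_mul_gauss_eq f] with x hx
    simp only [← mul_assoc]
    rw [integral_mul_const, hx t, gauss_eq]
    push_cast
    ring
  rw [integral_congr_ae h, integral_const_mul, integral_gaussR_sq, mul_one]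

lemma integrable_norm_stft_mul (f : M1 ι) (k : Phase ι → ℝ) (hk : AEStronglyMeasurable k) (C : ℝ)
    (hC : ∀ z, ‖k z‖ ≤ C) : Integrable fun z => ‖stft gauss (f : Vec ι → ℂ) z‖ * k z :=
  (M1.integrable_stft f).norm.mul_bdd hk (Filter.Eventually.of_forall hC)

lemma M1.norm_le_integral (f : M1 ι) (t : Vec ι) :
    ‖(f : Vec ι → ℂ) t‖ ≤
      ∫ z : Phase ι, ‖stft gauss (f : Vec ι → ℂ) z‖ * gaussR (t - pos z) := by
  rw [M1.inversion f t]
  refine (norm_integral_le_integral_norm _).trans (le_of_eq ?_)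
  simp only [norm_mul _ (_ * _), norm_atom]

lemma norm_gaussR_le (t : Vec ι) : ‖gaussR t‖ ≤ gaussMax ι := by
  rw [Real.norm_of_nonneg (gaussR_nonneg t)]
  exact gaussR_le t

lemma M1.norm_le (f : M1 ι) (t : Vec ι) : ‖(f : Vec ι → ℂ) t‖ ≤ gaussMax ι * M1norm f := by
  refine (M1.norm_le_integral f t).trans ?_
  rw [M1norm, mul_comm, ← integral_mul_const]
  refine integral_mono (integrable_norm_stft_mul f _
    (by fun_prop : Continuous fun z : Phase ι => gaussR (t - pos z)).aestronglyMeasurable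
    (gaussMax ι) fun z => norm_gaussR_le _) ((M1.integrable_stft f).norm.mul_const _) fun z => ?_
  exact mul_le_mul_of_nonneg_left (gaussR_le _) (norm_nonneg _)

/-- The fixed window supplies the decay in `t` that Fubini needs; the remaining kernel need only be
bounded. -/
lemma integrable_stft_prod_gaussR (f : M1 ι) (k : Phase ι × Vec ι → ℂ) (hk : Continuous k) (C : ℝ)
    (hC : ∀ p, ‖k p‖ ≤ C) (x : Vec ι) : Integrable (fun p : Phase ι × Vec ι =>
      stft gauss (f : Vec ι → ℂ) p.1 * gauss (p.2 - x) * k p) (volume.prod volume) := by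
  have h2 : Integrable fun t : Vec ι => gauss (t - x) :=
    (integrable_gaussR.ofReal (𝕜 := ℂ)).comp_sub_right x
  exact ((M1.integrable_stft f).mul_prod h2).mul_bdd hk.aestronglyMeasurable
    (Filter.Eventually.of_forall hC)

/-- Functions in `M¹` are integrable. -/
lemma M1.integrable (f : M1 ι) : Integrable (f : Vec ι → ℂ) := by
  have h1 : Integrable (fun p : Phase ι × Vec ι =>
      stft gauss (f : Vec ι → ℂ) p.1 * gauss p.2) (volume.prod volume) :=
    (M1.integrable_stft f).mul_prod (integrable_gaussR.ofReal (𝕜 := ℂ))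
  -- This measure-preserving shear moves the window to the origin, so joint integrability reduces to
  -- that of a tensor product.
  let T : Phase ι × Vec ι ≃ᵐ Phase ι × Vec ι :=
    (Homeomorph.mk (Equiv.mk (fun p => (p.1, p.2 - pos p.1)) (fun p => (p.1, p.2 + pos p.1))
      (fun p => by simp) (fun p => by simp)) (by fun_prop) (by fun_prop)).toMeasurableEquiv
  have hT : MeasurePreserving T (volume.prod volume) (volume.prod volume) := by
    refine MeasurePreserving.skew_product (f := id) (g := fun z t => t - pos z)
      (MeasurePreserving.id _) (by fun_prop) (Filter.Eventually.of_forall fun z => ?_)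
    exact (measurePreserving_sub_right volume (pos z)).map_eq
  have h2 : Integrable (fun p : Phase ι × Vec ι =>
      stft gauss (f : Vec ι → ℂ) p.1 * gauss (p.2 - pos p.1)) (volume.prod volume) :=
    hT.integrable_comp_of_integrable h1
  have h3 : Integrable (fun p : Phase ι × Vec ι =>
      stft gauss (f : Vec ι → ℂ) p.1 * gauss (p.2 - pos p.1) * chr (inner ℝ (freq p.1) p.2))
      (volume.prod volume) :=
    h2.mul_bdd (c := 1) (continuous_chr.comp (by fun_prop)).aestronglyMeasurable
      (Filter.Eventually.of_forall fun p => (norm_chr _).le)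
  refine h3.integral_prod_right.congr (Filter.Eventually.of_forall fun t => ?_)
  simp only
  rw [M1.inversion f t]
  refine integral_congr_ae (Filter.Eventually.of_forall fun z => ?_)
  simp only
  ring

/-- The reproducing estimate for the short-time Fourier transform, in the frequency variable. -/
lemma M1.norm_stft_le (f : M1 ι) (z₀ : Phase ι) :
    ‖stft gauss (f : Vec ι → ℂ) z₀‖ ≤ ∫ z : Phase ι,
      ‖stft gauss (f : Vec ι → ℂ) z‖ * Real.exp (-(Real.pi / 2) * ‖freq z - freq z₀‖ ^ 2) := by
  have hk : Continuous fun p : Phase ι × Vec ι =>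
      chr (inner ℝ (freq p.1 - freq z₀) p.2) * gauss (p.2 - pos p.1) :=
    (continuous_chr.comp (by fun_prop)).mul (by fun_prop)
  have hint := integrable_stft_prod_gaussR f _ hk (gaussMax ι) (fun p => by
    rw [norm_mul, norm_chr, one_mul, norm_gauss]
    exact gaussR_le _) (pos z₀)
  -- Inserting the inversion formula and exchanging the integrals leaves an ambiguity function of
  -- the Gaussian as kernel.
  have h : stft gauss (f : Vec ι → ℂ) z₀ = ∫ z : Phase ι, stft gauss (f : Vec ι → ℂ) z *
      ∫ t : Vec ι, chr (inner ℝ (freq z - freq z₀) t) *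
        ((gaussR (t - pos z) * gaussR (t - pos z₀) : ℝ) : ℂ) := by
    rw [stft_gauss_eq]
    have e : ∀ t, (f : Vec ι → ℂ) t * (chr (-inner ℝ (freq z₀) t) * gauss (t - pos z₀)) =
        ∫ z : Phase ι, stft gauss (f : Vec ι → ℂ) z * gauss (t - pos z₀) *
          (chr (inner ℝ (freq z - freq z₀) t) * gauss (t - pos z)) := by
      intro t
      rw [M1.inversion f t, ← integral_mul_const]
      refine integral_congr_ae (Filter.Eventually.of_forall fun z => ?_)
      have hchr : chr (inner ℝ (freq z - freq z₀) t) =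
          chr (inner ℝ (freq z) t) * chr (-inner ℝ (freq z₀) t) := by
        rw [← chr_add, inner_sub_left, sub_eq_add_neg]
      simp only [hchr]
      ring
    simp only [e]
    refine (integral_integral_swap ?_).trans ?_
    · exact hint.swap
    refine integral_congr_ae (Filter.Eventually.of_forall fun z => ?_)
    simp only
    rw [← integral_const_mul]
    refine integral_congr_ae (Filter.Eventually.of_forall fun t => ?_)
    simp only [gauss_eq]
    push_cast
    ring
  rw [h]
  refine (norm_integral_le_integral_norm _).trans ?_
  refine integral_mono_of_nonneg (Filter.Eventually.of_forall fun z => norm_nonneg _)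
    (integrable_norm_stft_mul f _ (by fun_prop : Continuous fun z : Phase ι =>
      Real.exp (-(Real.pi / 2) * ‖freq z - freq z₀‖ ^ 2)).aestronglyMeasurable 1 fun z => ?_)
    (Filter.Eventually.of_forall fun z => ?_)
  · rw [Real.norm_of_nonneg (Real.exp_pos _).le, Real.exp_le_one_iff]
    have := mul_nonneg (by positivity : 0 ≤ Real.pi / 2) (sq_nonneg ‖freq z - freq z₀‖)
    linarith
  · simp only [norm_mul]
    exact mul_le_mul_of_nonneg_left (norm_integral_chr_gaussR_mul_le _ _ _) (norm_nonneg _)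

/-- Fourier coefficients of a product of functions in `M¹`, bounded by a correlation of their
short-time Fourier transforms. -/
lemma norm_integral_mul_chr_mul_conj_le (σ τ : M1 ι) (ξ : Vec ι) :
    ‖∫ t, (σ : Vec ι → ℂ) t * chr (-inner ℝ ξ t) * conj ((τ : Vec ι → ℂ) t)‖ ≤
      ∫ z : Phase ι, ‖stft gauss (τ : Vec ι → ℂ) z‖ *
        ‖stft gauss (σ : Vec ι → ℂ) (z + phasePt 0 ξ)‖ := by
  have hg : Continuous fun p : Phase ι × Vec ι =>
      conj (chr (inner ℝ (freq p.1) p.2) * gauss (p.2 - pos p.1)) :=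
    Complex.continuous_conj.comp ((continuous_chr.comp (by fun_prop)).mul (by fun_prop))
  have hτ : Integrable fun z : Phase ι => conj (stft gauss (τ : Vec ι → ℂ) z) :=
    (Complex.conjCLE.toContinuousLinearMap.integrable_comp (M1.integrable_stft τ))
  have hσ : Integrable fun t => (σ : Vec ι → ℂ) t * chr (-inner ℝ ξ t) :=
    (M1.integrable σ).mul_bdd (c := 1)
      (continuous_chr.comp (by fun_prop)).aestronglyMeasurable
      (Filter.Eventually.of_forall fun p => (norm_chr _).le)
  have hint := (hτ.mul_prod hσ).mul_bdd (c := gaussMax ι) hg.aestronglyMeasurable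
    (Filter.Eventually.of_forall fun p => by
      rw [RCLike.norm_conj, norm_atom]
      exact gaussR_le _)
  -- Only `τ` is expanded; the remaining `t`-integral is the transform of `σ` at a frequency raised
  -- by `ξ`.
  have h : ∫ t, (σ : Vec ι → ℂ) t * chr (-inner ℝ ξ t) * conj ((τ : Vec ι → ℂ) t) =
      ∫ z : Phase ι, conj (stft gauss (τ : Vec ι → ℂ) z) *
        stft gauss (σ : Vec ι → ℂ) (z + phasePt 0 ξ) := by
    have e : ∀ t, (σ : Vec ι → ℂ) t * chr (-inner ℝ ξ t) * conj ((τ : Vec ι → ℂ) t) =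
        ∫ z : Phase ι, conj (stft gauss (τ : Vec ι → ℂ) z) *
          ((σ : Vec ι → ℂ) t * chr (-inner ℝ ξ t)) *
          conj (chr (inner ℝ (freq z) t) * gauss (t - pos z)) := by
      intro t
      rw [M1.inversion τ t, ← integral_conj, ← integral_const_mul]
      refine integral_congr_ae (Filter.Eventually.of_forall fun z => ?_)
      simp only [map_mul]
      ring
    simp only [e]
    refine (integral_integral_swap ?_).trans ?_
    · exact hint.swap
    refine integral_congr_ae (Filter.Eventually.of_forall fun z => ?_)
    simp only
    rw [stft_gauss_eq _ (z + phasePt 0 ξ), ← integral_const_mul]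
    refine integral_congr_ae (Filter.Eventually.of_forall fun t => ?_)
    have e1 : pos (z + phasePt 0 ξ) = pos z := add_zero (pos z)
    have e2 : freq (z + phasePt 0 ξ) = freq z + ξ := rfl
    simp only [e1, e2, inner_add_left, neg_add, chr_add, map_mul, conj_chr, gauss_eq,
      Complex.conj_ofReal]
    ring
  rw [h]
  refine (norm_integral_le_integral_norm _).trans (le_of_eq ?_)
  simp only [norm_mul, RCLike.norm_conj]

end Reconstruction

section LatticeSums

/-! ### Gaussian sums over lattices -/

lemma summable_exp_neg_mul_int_sq {a : ℝ} (ha : 0 < a) :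
    Summable fun k : ℤ => Real.exp (-a * (k : ℝ) ^ 2) := by
  have hnat : Summable fun k : ℕ => Real.exp (-a * (k : ℝ) ^ 2) := by
    refine Summable.of_nonneg_of_le (fun k => (Real.exp_pos _).le) (fun k => ?_)
      (summable_geometric_of_lt_one (Real.exp_pos (-a)).le
        (Real.exp_lt_one_iff.2 (neg_neg_of_pos ha)))
    rw [← Real.exp_nat_mul, Real.exp_le_exp]
    have h : (k : ℝ) ≤ (k : ℝ) ^ 2 := by
      exact_mod_cast Nat.le_self_pow two_ne_zero k
    nlinarith
  refine Summable.of_nat_of_neg (by simpa using hnat) (by simpa using hnat)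

/-- Replacing `v` by its floor costs half the exponent and a factor `e^a`, by `(p+q)² ≤ 2p² + 2q²`;
the remaining sum is invariant under integer shifts. -/
lemma exists_sum_exp_int_le {a : ℝ} (ha : 0 < a) :
    ∃ C : ℝ, ∀ (v : ℝ) (s : Finset ℤ), ∑ k ∈ s, Real.exp (-a * ((k : ℝ) - v) ^ 2) ≤ C := by
  have hsum := summable_exp_neg_mul_int_sq (half_pos ha)
  refine ⟨Real.exp a * ∑' k : ℤ, Real.exp (-(a / 2) * (k : ℝ) ^ 2), fun v s => ?_⟩
  have hterm : ∀ k : ℤ, Real.exp (-a * ((k : ℝ) - v) ^ 2) ≤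
      Real.exp a * Real.exp (-(a / 2) * ((k - ⌊v⌋ : ℤ) : ℝ) ^ 2) := by
    intro k
    rw [← Real.exp_add, Real.exp_le_exp]
    have h1 := Int.floor_le v
    have h2 := Int.lt_floor_add_one v
    set r := v - ⌊v⌋ with hr
    have h3 : r ^ 2 ≤ 1 := by
      have : 0 ≤ r := by linarith
      have : r < 1 := by linarith
      nlinarith
    push_cast
    have h4 : ((k : ℝ) - ⌊v⌋) ^ 2 ≤ 2 * ((k : ℝ) - v) ^ 2 + 2 * r ^ 2 := by
      nlinarith [sq_nonneg ((k : ℝ) - v - r)]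
    nlinarith
  refine (Finset.sum_le_sum fun k _ => hterm k).trans ?_
  rw [← Finset.mul_sum]
  refine mul_le_mul_of_nonneg_left ?_ (Real.exp_pos _).le
  have h := (hsum.comp_injective (Equiv.subRight ⌊v⌋).injective).sum_le_tsum s
    fun k _ => (Real.exp_pos _).le
  refine h.trans (le_of_eq ?_)
  exact (Equiv.subRight ⌊v⌋).tsum_eq fun k : ℤ => Real.exp (-(a / 2) * (k : ℝ) ^ 2)

variable {κ : Type} [Fintype κ]

lemma exists_sum_exp_lattice_le (T : (κ → ℝ) ≃L[ℝ] Vec κ) {c : ℝ} (hc : 0 < c) :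
    ∃ C : ℝ, ∀ (x : Vec κ) (s : Finset (κ → ℤ)),
      ∑ n ∈ s, Real.exp (-c * ‖T (intVec n) - x‖ ^ 2) ≤ C := by
  classical
  -- The added ones in `K` and `N` keep both positive even when `κ` is empty.
  set K : ℝ := ‖(T.symm : Vec κ →L[ℝ] κ → ℝ)‖ + 1 with hK
  have hKpos : 0 < K := by positivity
  set N : ℝ := Fintype.card κ + 1 with hN
  have hNpos : 0 < N := by positivity
  set a : ℝ := c / (K ^ 2 * N) with ha
  have hapos : 0 < a := by positivity
  obtain ⟨C₁, hC₁⟩ := exists_sum_exp_int_le hapos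
  refine ⟨C₁ ^ Fintype.card κ, fun x s => ?_⟩
  set v : κ → ℝ := T.symm x with hv
  have hterm : ∀ n : κ → ℤ, Real.exp (-c * ‖T (intVec n) - x‖ ^ 2) ≤
      ∏ i, Real.exp (-a * ((n i : ℝ) - v i) ^ 2) := by
    intro n
    rw [← Real.exp_sum, Real.exp_le_exp, ← Finset.mul_sum]
    have h1 : ‖intVec n - v‖ ≤ K * ‖T (intVec n) - x‖ := by
      have h : intVec n - v = (T.symm : Vec κ →L[ℝ] κ → ℝ) (T (intVec n) - x) := by
        simp [hv]
      rw [h]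
      refine (ContinuousLinearMap.le_opNorm _ _).trans ?_
      exact mul_le_mul_of_nonneg_right (by linarith) (norm_nonneg _)
    have h2 : ∑ i, ((n i : ℝ) - v i) ^ 2 ≤ N * ‖intVec n - v‖ ^ 2 := by
      have : ∀ i ∈ Finset.univ, ((n i : ℝ) - v i) ^ 2 ≤ ‖intVec n - v‖ ^ 2 := by
        intro i _
        rw [← sq_abs]
        exact pow_le_pow_left₀ (abs_nonneg _) (norm_le_pi_norm (intVec n - v) i) 2
      refine (Finset.sum_le_card_nsmul _ _ _ this).trans ?_
      rw [nsmul_eq_mul, Finset.card_univ]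
      exact mul_le_mul_of_nonneg_right (by linarith) (sq_nonneg _)
    have h3 : ‖intVec n - v‖ ^ 2 ≤ K ^ 2 * ‖T (intVec n) - x‖ ^ 2 := by
      rw [← mul_pow]
      exact pow_le_pow_left₀ (norm_nonneg _) h1 2
    have h4 : a * ∑ i, ((n i : ℝ) - v i) ^ 2 ≤ c * ‖T (intVec n) - x‖ ^ 2 := by
      calc a * ∑ i, ((n i : ℝ) - v i) ^ 2
          ≤ a * (N * (K ^ 2 * ‖T (intVec n) - x‖ ^ 2)) := by gcongr; exact h2.trans (by gcongr)
        _ = c * ‖T (intVec n) - x‖ ^ 2 := by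
            rw [ha]
            field_simp
    linarith
  refine (Finset.sum_le_sum fun n _ => hterm n).trans ?_
  -- Enlarging `s` to the product of its coordinate projections turns the sum into a product of
  -- one-dimensional sums.
  have hsub : s ⊆ Fintype.piFinset fun i => s.image fun n => n i := by
    intro n hn
    rw [Fintype.mem_piFinset]
    exact fun i => Finset.mem_image_of_mem _ hn
  refine (Finset.sum_le_sum_of_subset_of_nonneg hsub fun n _ _ =>
    Finset.prod_nonneg fun i _ => (Real.exp_pos _).le).trans ?_
  rw [← Finset.prod_univ_sum (fun i => s.image fun n => n i)
    fun i (k : ℤ) => Real.exp (-a * ((k : ℝ) - v i) ^ 2)]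
  refine (Finset.prod_le_prod (fun i _ => Finset.sum_nonneg fun k _ => (Real.exp_pos _).le)
    fun i _ => hC₁ (v i) _).trans ?_
  rw [Finset.prod_const, Finset.card_univ]

/-- Integrating a family of kernels with bounded sums gives a summable family. -/
lemma sum_integral_le {X N : Type*} [MeasurableSpace X] {μ : Measure X} {F : X → ℝ}
    (hF : Integrable F μ) (hF0 : ∀ x, 0 ≤ F x) {k : N → X → ℝ}
    (hk : ∀ n, AEStronglyMeasurable (k n) μ) (hk0 : ∀ n x, 0 ≤ k n x) {C : ℝ}
    (hC : ∀ x (s : Finset N), ∑ n ∈ s, k n x ≤ C) (s : Finset N) :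
    ∑ n ∈ s, ∫ x, F x * k n x ∂μ ≤ C * ∫ x, F x ∂μ := by
  have hint : ∀ n, Integrable (fun x => F x * k n x) μ := fun n =>
    hF.mul_bdd (c := C) (hk n) (Filter.Eventually.of_forall fun x => by
      rw [Real.norm_of_nonneg (hk0 n x)]
      simpa using hC x {n})
  rw [← integral_finsetSum s fun n _ => hint n, ← integral_const_mul]
  refine integral_mono (integrable_finsetSum s fun n _ => hint n) (hF.const_mul C) fun x => ?_
  simp only
  rw [← Finset.mul_sum, mul_comm]
  exact mul_le_mul_of_nonneg_right (hC x s) (hF0 x)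

lemma summable_integral {X N : Type*} [MeasurableSpace X] {μ : Measure X} {F : X → ℝ}
    (hF : Integrable F μ) (hF0 : ∀ x, 0 ≤ F x) {k : N → X → ℝ}
    (hk : ∀ n, AEStronglyMeasurable (k n) μ) (hk0 : ∀ n x, 0 ≤ k n x) {C : ℝ}
    (hC : ∀ x (s : Finset N), ∑ n ∈ s, k n x ≤ C) :
    Summable fun n => ∫ x, F x * k n x ∂μ :=
  summable_of_sum_le (fun n => integral_nonneg fun x => mul_nonneg (hF0 x) (hk0 n x))
    (sum_integral_le hF hF0 hk hk0 hC)

/-! ### Sampling and Poisson summation in `M¹` -/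

/-- Functions in `M¹` lie in the Wiener amalgam space: their local suprema over lattice translates
are summable. -/
lemma M1.exists_summable_bound (f : M1 κ) (T : (κ → ℝ) ≃L[ℝ] Vec κ) (c : κ → ℝ) :
    ∃ b : (κ → ℤ) → ℝ, Summable b ∧
      ∀ n y, ‖y - c‖ ≤ 1 → ‖(f : Vec κ → ℂ) (T (y + intVec n))‖ ≤ b n := by
  set R : ℝ := ‖(T : (κ → ℝ) →L[ℝ] Vec κ)‖ with hR
  -- Moving `y` within distance 1 of `c` displaces `T y` by at most `R`. By `‖p‖² ≤ 2‖p+q‖² + 2R²`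
  -- this halves the exponent `π` and costs `e^{πR²}`.
  set A : ℝ := gaussMax κ * Real.exp (Real.pi * R ^ 2) with hA
  have hA0 : 0 ≤ A := by rw [hA]; unfold gaussMax; positivity
  have hcont : ∀ n : κ → ℤ, Continuous fun z : Phase κ =>
      A * Real.exp (-(Real.pi / 2) * ‖T (intVec n) - (pos z - T c)‖ ^ 2) := by
    intro n; fun_prop
  obtain ⟨C, hC⟩ := exists_sum_exp_lattice_le T (half_pos Real.pi_pos)
  refine ⟨fun n => ∫ z : Phase κ, ‖stft gauss (f : Vec κ → ℂ) z‖ *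
    (A * Real.exp (-(Real.pi / 2) * ‖T (intVec n) - (pos z - T c)‖ ^ 2)),
    summable_integral (M1.integrable_stft f).norm (fun _ => norm_nonneg _)
      (fun n => (hcont n).aestronglyMeasurable) (fun n z => by positivity) (C := A * C)
      (fun z s => ?_), fun n y hy => ?_⟩
  · rw [← Finset.mul_sum]
    exact mul_le_mul_of_nonneg_left (hC _ s) hA0
  · refine (M1.norm_le_integral f _).trans ?_
    refine integral_mono_of_nonneg (Filter.Eventually.of_forall fun z =>
      mul_nonneg (norm_nonneg _) (gaussR_nonneg _))
      (integrable_norm_stft_mul f _ (hcont n).aestronglyMeasurable A fun z => ?_)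
      (Filter.Eventually.of_forall fun z => mul_le_mul_of_nonneg_left ?_ (norm_nonneg _))
    · rw [Real.norm_of_nonneg (by positivity)]
      refine mul_le_of_le_one_right hA0 (Real.exp_le_one_iff.2 ?_)
      have := mul_nonneg (half_pos Real.pi_pos).le
        (sq_nonneg ‖T (intVec n) - (pos z - T c)‖)
      linarith
    · rw [hA, mul_assoc, ← Real.exp_add]
      refine mul_le_mul_of_nonneg_left (Real.exp_le_exp.2 ?_) (by positivity)
      set p := T (intVec n) - (pos z - T c) with hp
      set q := T (y - c) with hq
      have h1 : T (y + intVec n) - pos z = p + q := by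
        rw [hp, hq, map_add, map_sub]
        abel
      have h2 : ‖q‖ ≤ R := by
        refine ((T : (κ → ℝ) →L[ℝ] Vec κ).le_opNorm (y - c)).trans ?_
        exact mul_le_of_le_one_right (norm_nonneg _) hy
      have h3 : ‖p‖ ≤ ‖p + q‖ + ‖q‖ := by
        simpa using norm_sub_le (p + q) q
      have h4 : ‖p‖ ^ 2 ≤ 2 * ‖p + q‖ ^ 2 + 2 * R ^ 2 := by
        have : ‖p‖ ^ 2 ≤ (‖p + q‖ + R) ^ 2 :=
          pow_le_pow_left₀ (norm_nonneg _) (by linarith) 2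
        nlinarith [sq_nonneg (‖p + q‖ - R)]
      rw [h1]
      nlinarith [Real.pi_pos]

/-- Samples of a function in `M¹` on a lattice are absolutely summable. -/
lemma M1.summable_norm_lattice (f : M1 κ) (T : (κ → ℝ) ≃L[ℝ] Vec κ) :
    Summable fun n : κ → ℤ => ‖(f : Vec κ → ℂ) (T (intVec n))‖ := by
  obtain ⟨b, hb, h⟩ := M1.exists_summable_bound f T 0
  refine Summable.of_nonneg_of_le (fun _ => norm_nonneg _) (fun n => ?_) hb
  simpa using h n 0 (by simp)

/-- The frequency shifts of `|V_φ σ|` over the lattice have sums bounded uniformly in `z`, so their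
integrals against `|V_φ τ|` are summable. -/
lemma summable_integral_mul_chr_mul_conj (σ τ : M1 κ) (T : (κ → ℝ) ≃L[ℝ] Vec κ) :
    Summable fun n : κ → ℤ => ∫ t, (σ : Vec κ → ℂ) t * chr (-inner ℝ (T (intVec n)) t) *
      conj ((τ : Vec κ → ℂ) t) := by
  obtain ⟨C, hC⟩ := exists_sum_exp_lattice_le T (half_pos Real.pi_pos)
  have hstft : ∀ (z : Phase κ) (s : Finset (κ → ℤ)),
      ∑ n ∈ s, ‖stft gauss (σ : Vec κ → ℂ) (z + phasePt 0 (T (intVec n)))‖ ≤ C * M1norm σ := by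
    intro z s
    refine (Finset.sum_le_sum fun n _ => M1.norm_stft_le σ _).trans ?_
    refine sum_integral_le (M1.integrable_stft σ).norm (fun _ => norm_nonneg _)
      (fun n => ?_) (fun n z' => (Real.exp_pos _).le) (fun z' s' => ?_) s
    · exact (by fun_prop : Continuous fun z' : Phase κ => Real.exp (-(Real.pi / 2) *
        ‖freq z' - freq (z + phasePt 0 (T (intVec n)))‖ ^ 2)).aestronglyMeasurable
    · refine le_trans (le_of_eq (Finset.sum_congr rfl fun n _ => ?_)) (hC (freq z' - freq z) s')
      have e : freq (z + phasePt 0 (T (intVec n))) = freq z + T (intVec n) := rfl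
      rw [e, ← norm_neg]
      congr 4
      abel
  refine Summable.of_norm_bounded (summable_integral (M1.integrable_stft τ).norm
    (fun _ => norm_nonneg _) (fun n => ?_) (fun n z => norm_nonneg _) hstft)
    fun n => norm_integral_mul_chr_mul_conj_le σ τ (T (intVec n))
  exact (((M1.integrable_stft σ).comp_add_right (phasePt 0 (T (intVec n)))).norm).1

/-- Poisson summation for a product of functions in `M¹`, over a lattice and its dual. -/
theorem hasSum_integral_mul_chr_mul_conj (σ τ : M1 κ) (T T' : (κ → ℝ) ≃L[ℝ] Vec κ)
    (hTT' : ∀ x y, inner ℝ (T' x) (T y) = ∑ i, x i * y i) {c : ℝ} (hc : 0 < c)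
    (hT : Measure.map T volume = ENNReal.ofReal c • (volume : Measure (Vec κ))) :
    HasSum (fun n : κ → ℤ => ∫ t, (σ : Vec κ → ℂ) t * chr (-inner ℝ (T' (intVec n)) t) *
        conj ((τ : Vec κ → ℂ) t))
      ((c : ℂ)⁻¹ * ∑' n : κ → ℤ, (σ : Vec κ → ℂ) (T (intVec n)) *
        conj ((τ : Vec κ → ℂ) (T (intVec n)))) := by
  have hemb : MeasurableEmbedding T := T.toHomeomorph.measurableEmbedding
  set g : (κ → ℝ) → ℂ := fun y => (σ : Vec κ → ℂ) (T y) * conj ((τ : Vec κ → ℂ) (T y)) with hg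
  have hgc : Continuous g :=
    ((M1.continuous σ).comp T.continuous).mul
      (Complex.continuous_conj.comp ((M1.continuous τ).comp T.continuous))
  have hgi : Integrable g := by
    have h : Integrable (fun t => (σ : Vec κ → ℂ) t * conj ((τ : Vec κ → ℂ) t)) :=
      (M1.integrable σ).mul_bdd (c := gaussMax κ * M1norm τ)
        (Complex.continuous_conj.comp (M1.continuous τ)).aestronglyMeasurable
        (Filter.Eventually.of_forall fun t => by
          rw [RCLike.norm_conj]
          exact M1.norm_le τ t)
    have h2 := h.smul_measure (c := ENNReal.ofReal c) ENNReal.ofReal_ne_top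
    rw [← hT, hemb.integrable_map_iff] at h2
    exact h2
  have hcoef : ∀ n : κ → ℤ, ∫ y, g y * chr (-∑ i, n i * y i) =
      c * ∫ t, (σ : Vec κ → ℂ) t * chr (-inner ℝ (T' (intVec n)) t) *
        conj ((τ : Vec κ → ℂ) t) := by
    intro n
    have h := hemb.integral_map (μ := volume) fun t => (σ : Vec κ → ℂ) t *
      chr (-inner ℝ (T' (intVec n)) t) * conj ((τ : Vec κ → ℂ) t)
    rw [hT, integral_smul_measure, ENNReal.toReal_ofReal hc.le] at h
    rw [← Complex.real_smul, h]
    refine integral_congr_ae (Filter.Eventually.of_forall fun y => ?_)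
    simp only [hg, hTT', intVec]
    ring
  have hs := summable_integral_mul_chr_mul_conj σ τ T'
  have hs' : Summable fun n : κ → ℤ => ∫ y, g y * chr (-∑ i, n i * y i) := by
    simp only [hcoef]
    exact hs.mul_left _
  have hp := poisson_summation hgc hgi (fun a => ?_) hs'
  · simp only [hcoef] at hp
    rw [tsum_mul_left] at hp
    have hc' : (c : ℂ) ≠ 0 := Complex.ofReal_ne_zero.2 hc.ne'
    rw [show ∑' n : κ → ℤ, (σ : Vec κ → ℂ) (T (intVec n)) * conj ((τ : Vec κ → ℂ) (T (intVec n)))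
      = ∑' n : κ → ℤ, g (intVec n) from rfl, ← hp, inv_mul_cancel_left₀ hc']
    exact hs.hasSum
  -- Amalgam control of one factor suffices; the other enters through its supremum.
  · obtain ⟨b, hb, h⟩ := M1.exists_summable_bound σ T a
    refine ⟨fun n => b n * (gaussMax κ * M1norm τ), hb.mul_right _, fun n y hy => ?_⟩
    simp only [hg, norm_mul, RCLike.norm_conj]
    exact mul_le_mul (h n y hy) (M1.norm_le τ _) (norm_nonneg _)
      ((norm_nonneg _).trans (h n y hy))

end LatticeSums

/-! ### The lattice and its adjoint -/

section Lattice

set_option linter.unusedSectionVars false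

variable {κ : Type} [Fintype κ] [DecidableEq κ]

/-- An invertible matrix as an equivalence of coordinate space with Euclidean space. -/
def matrixEquiv (Q : Matrix κ κ ℝ) (h : IsUnit Q.det) : (κ → ℝ) ≃L[ℝ] Vec κ :=
  ((Matrix.toLin'OfInv (Matrix.nonsing_inv_mul Q h) (Matrix.mul_nonsing_inv Q h)).trans
    (WithLp.linearEquiv 2 ℝ (κ → ℝ)).symm).toContinuousLinearEquiv

lemma matrixEquiv_apply (Q : Matrix κ κ ℝ) (h : IsUnit Q.det) (x : κ → ℝ) :
    matrixEquiv Q h x = WithLp.toLp 2 (Q.mulVec x) := rfl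

lemma inner_toLp (x y : κ → ℝ) :
    inner ℝ (WithLp.toLp 2 x : Vec κ) (WithLp.toLp 2 y) = x ⬝ᵥ y := by
  simp [PiLp.inner_apply, dotProduct, mul_comm]

lemma isUnit_det_transpose_inv {Q : Matrix κ κ ℝ} (h : IsUnit Q.det) :
    IsUnit (Q.transpose⁻¹).det := by
  rw [Matrix.isUnit_nonsing_inv_det_iff, Matrix.det_transpose]
  exact h

lemma inner_matrixEquiv (Q : Matrix κ κ ℝ) (h : IsUnit Q.det) (x y : κ → ℝ) :
    inner ℝ (matrixEquiv Q h x) (matrixEquiv Q.transpose⁻¹ (isUnit_det_transpose_inv h) y) =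
      ∑ i, x i * y i := by
  rw [matrixEquiv_apply, matrixEquiv_apply, inner_toLp, ← Matrix.vecMul_transpose,
    ← Matrix.dotProduct_mulVec, Matrix.mulVec_mulVec,
    Matrix.mul_nonsing_inv _ (by rwa [Matrix.det_transpose]),
    Matrix.one_mulVec]
  rfl

lemma map_matrixEquiv_volume (Q : Matrix κ κ ℝ) (h : IsUnit Q.det) :
    Measure.map (matrixEquiv Q h) volume =
      ENNReal.ofReal |Q.det⁻¹| • (volume : Measure (Vec κ)) := by
  have h1 := Real.map_matrix_volume_pi_eq_smul_volume_pi h.ne_zero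
  have h2 : (matrixEquiv Q h : (κ → ℝ) → Vec κ) = WithLp.toLp 2 ∘ Matrix.toLin' Q := by
    funext x
    rfl
  have hm : Measurable (Matrix.toLin' Q : (κ → ℝ) → κ → ℝ) :=
    (LinearMap.continuous_of_finiteDimensional _).measurable
  have hp := PiLp.volume_preserving_toLp κ
  rw [h2, ← Measure.map_map hp.measurable hm, h1, Measure.map_smul, hp.map_eq]

/-- Passing to the dual lattice inverts the determinant, so the constant in Poisson summation is
`|Λ|` itself. -/
lemma map_matrixEquiv_transpose_inv_volume (Q : Matrix κ κ ℝ) (h : IsUnit Q.det) :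
    Measure.map (matrixEquiv Q.transpose⁻¹ (isUnit_det_transpose_inv h)) volume =
      ENNReal.ofReal |Q.det| • (volume : Measure (Vec κ)) := by
  rw [map_matrixEquiv_volume, Matrix.det_nonsing_inv, Matrix.det_transpose,
    Ring.inverse_eq_inv', inv_inv]

lemma chr_eq_one_iff {s : ℝ} : chr s = 1 ↔ ∃ n : ℤ, s = n := by
  constructor
  · intro h
    rw [chr, Complex.exp_eq_one_iff] at h
    obtain ⟨n, hn⟩ := h
    refine ⟨n, ?_⟩
    have h2 : (s : ℂ) = ((n : ℝ) : ℂ) := by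
      have h0 : (2 * Real.pi * Complex.I : ℂ) ≠ 0 := Complex.two_pi_I_ne_zero
      apply mul_left_cancel₀ h0
      rw [hn]
      push_cast
      ring
    exact_mod_cast h2
  · rintro ⟨n, rfl⟩
    exact chr_int n

lemma intVec_injective : Function.Injective (intVec : (κ → ℤ) → κ → ℝ) := by
  intro m n h
  funext i
  exact Int.cast_injective (congrFun h i)

variable {ι : Type} [Fintype ι] [DecidableEq ι]

/-- The matrix `JA`, whose columns represent `Ω(·, Aeᵢ)`. -/
def sympMatrix (A : Matrix.GeneralLinearGroup (ι ⊕ ι) ℝ) : Matrix (ι ⊕ ι) (ι ⊕ ι) ℝ :=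
  Matrix.J ι ℝ * (A : Matrix (ι ⊕ ι) (ι ⊕ ι) ℝ)

lemma isUnit_det_coe (A : Matrix.GeneralLinearGroup (ι ⊕ ι) ℝ) :
    IsUnit (A : Matrix (ι ⊕ ι) (ι ⊕ ι) ℝ).det := (Matrix.isUnit_iff_isUnit_det _).1 A.isUnit

lemma isUnit_det_sympMatrix (A : Matrix.GeneralLinearGroup (ι ⊕ ι) ℝ) :
    IsUnit (sympMatrix A).det := by
  rw [sympMatrix, Matrix.det_mul]
  exact (Matrix.isUnit_det_J ι ℝ).mul (isUnit_det_coe A)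

lemma abs_det_sympMatrix (A : Matrix.GeneralLinearGroup (ι ⊕ ι) ℝ) :
    |(sympMatrix A).det| = latticeVol A := by
  have h : |(Matrix.J ι ℝ).det| = 1 := by
    have h1 := Matrix.J_det_mul_J_det ι ℝ
    rw [← abs_mul_abs_self] at h1
    nlinarith [abs_nonneg (Matrix.J ι ℝ).det]
  rw [sympMatrix, Matrix.det_mul, abs_mul, h, one_mul, latticeVol]

lemma latticeVol_pos (A : Matrix.GeneralLinearGroup (ι ⊕ ι) ℝ) : 0 < latticeVol A :=
  abs_pos.2 (isUnit_det_coe A).ne_zero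

/-- The parametrisation of phase space by the lattice `JΛ`. -/
def rotatedLatticeEquiv (A : Matrix.GeneralLinearGroup (ι ⊕ ι) ℝ) : (ι ⊕ ι → ℝ) ≃L[ℝ] Phase ι :=
  matrixEquiv (sympMatrix A) (isUnit_det_sympMatrix A)

/-- The parametrisation of phase space by the adjoint lattice. -/
def adjointLatticeEquiv (A : Matrix.GeneralLinearGroup (ι ⊕ ι) ℝ) : (ι ⊕ ι → ℝ) ≃L[ℝ] Phase ι :=
  matrixEquiv (sympMatrix A).transpose⁻¹ (isUnit_det_transpose_inv (isUnit_det_sympMatrix A))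

/-- The point `Ax` of phase space. -/
def latticePt (A : Matrix.GeneralLinearGroup (ι ⊕ ι) ℝ) (x : ι ⊕ ι → ℝ) : Phase ι :=
  WithLp.toLp 2 (Matrix.mulVec (A : Matrix (ι ⊕ ι) (ι ⊕ ι) ℝ) x)

lemma latticePt_injective (A : Matrix.GeneralLinearGroup (ι ⊕ ι) ℝ) :
    Function.Injective (latticePt A) := by
  have h : latticePt A = matrixEquiv (A : Matrix (ι ⊕ ι) (ι ⊕ ι) ℝ) (isUnit_det_coe A) := rfl
  rw [h]
  exact (matrixEquiv _ _).injective

/-- The matrix `J` turns the symplectic pairing into the Euclidean one, which identifies `Λ°` with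
the dual lattice of `JΛ`. -/
lemma inner_rotatedLatticeEquiv (A : Matrix.GeneralLinearGroup (ι ⊕ ι) ℝ) (x : ι ⊕ ι → ℝ)
    (z : Phase ι) : inner ℝ (rotatedLatticeEquiv A x) z = symp z (latticePt A x) := by
  rw [rotatedLatticeEquiv, matrixEquiv_apply, sympMatrix, ← Matrix.mulVec_mulVec]
  simp only [symp, latticePt]
  set v := (A : Matrix (ι ⊕ ι) (ι ⊕ ι) ℝ).mulVec x
  have hJ : (Matrix.J ι ℝ).mulVec v =
      Sum.elim (fun i => -v (Sum.inr i)) (fun i => v (Sum.inl i)) := by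
    conv_lhs => rw [Matrix.J, Matrix.fromBlocks_mulVec]
    funext i
    cases i <;> simp [Matrix.neg_mulVec]
  rw [hJ]
  simp only [PiLp.inner_apply, Fintype.sum_sum_type, pos, freq]
  simp only [Sum.elim_inl, Sum.elim_inr, RCLike.inner_apply, conj_trivial]
  simp only [mul_neg, Finset.sum_neg_distrib]
  rw [neg_add_eq_sub]
  simp only [mul_comm]

lemma adjointLatticeEquiv_mem_iff (A : Matrix.GeneralLinearGroup (ι ⊕ ι) ℝ) (y : ι ⊕ ι → ℝ) :
    adjointLatticeEquiv A y ∈ adjointLattice (lattice A) ↔ ∃ n : ι ⊕ ι → ℤ, y = intVec n := by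
  have hkey : ∀ n : ι ⊕ ι → ℤ, symp (adjointLatticeEquiv A y) (latticePt A (intVec n)) =
      ∑ i, n i * y i := by
    intro n
    rw [← inner_rotatedLatticeEquiv]
    exact inner_matrixEquiv _ _ _ _
  have h1 : adjointLatticeEquiv A y ∈ adjointLattice (lattice A) ↔
      ∀ n : ι ⊕ ι → ℤ, chr (∑ i, n i * y i) = 1 := by
    constructor
    · intro h n
      rw [← hkey]
      exact h _ ⟨n, rfl⟩
    · rintro h _ ⟨n, rfl⟩
      rw [← h n, ← hkey]
      rfl
  rw [h1]
  constructor
  · intro h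
    have h2 : ∀ i, ∃ m : ℤ, y i = m := by
      intro i
      -- Testing on a basis vector isolates one coordinate.
      have h3 := h (Pi.single i 1)
      rw [chr_eq_one_iff] at h3
      obtain ⟨m, hm⟩ := h3
      refine ⟨m, ?_⟩
      rw [← hm]
      rw [Finset.sum_eq_single i]
      · simp
      · intro j _ hj
        simp [hj]
      · simp
    choose m hm using h2
    exact ⟨m, funext hm⟩
  · rintro ⟨m, rfl⟩ n
    rw [chr_eq_one_iff]
    exact ⟨∑ i, n i * m i, by simp [intVec]⟩

/-- The enumeration of the lattice `Λ` by integer vectors. -/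
def latticeEnum (A : Matrix.GeneralLinearGroup (ι ⊕ ι) ℝ) : (ι ⊕ ι → ℤ) ≃ lattice A :=
  Equiv.ofBijective (fun n => ⟨latticePt A (intVec n), ⟨n, rfl⟩⟩) ⟨fun m n h =>
    intVec_injective (latticePt_injective A (Subtype.ext_iff.1 h)), by
      rintro ⟨_, n, rfl⟩
      exact ⟨n, rfl⟩⟩

/-- The enumeration of the adjoint lattice `Λ°` by integer vectors. -/
def adjointLatticeEnum (A : Matrix.GeneralLinearGroup (ι ⊕ ι) ℝ) :
    (ι ⊕ ι → ℤ) ≃ adjointLattice (lattice A) :=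
  Equiv.ofBijective
    (fun n => ⟨adjointLatticeEquiv A (intVec n), (adjointLatticeEquiv_mem_iff A _).2 ⟨n, rfl⟩⟩)
    ⟨fun m n h => intVec_injective ((adjointLatticeEquiv A).injective (Subtype.ext_iff.1 h)), by
      rintro ⟨z, hz⟩
      obtain ⟨y, rfl⟩ := (adjointLatticeEquiv A).surjective z
      obtain ⟨n, rfl⟩ := (adjointLatticeEquiv_mem_iff A y).1 hz
      exact ⟨n, rfl⟩⟩

lemma symp_antisymm (z w : Phase ι) : symp z w = -symp w z := by
  simp [symp]

lemma summable_norm_adjointLattice (A : Matrix.GeneralLinearGroup (ι ⊕ ι) ℝ) (σ : M1 (ι ⊕ ι)) :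
    Summable fun μ : adjointLattice (lattice A) => ‖(σ : Phase ι → ℂ) μ.1‖ := by
  rw [← (adjointLatticeEnum A).summable_iff]
  exact M1.summable_norm_lattice σ (adjointLatticeEquiv A)

/-- Symplectic Poisson summation for a product of functions in `M¹`. -/
theorem hasSum_lattice_integral (A : Matrix.GeneralLinearGroup (ι ⊕ ι) ℝ) (σ τ : M1 (ι ⊕ ι)) :
    HasSum (fun l : lattice A => ∫ z : Phase ι, (σ : Phase ι → ℂ) z * chr (symp l.1 z) *
        conj ((τ : Phase ι → ℂ) z))
      ((latticeVol A : ℂ)⁻¹ * ∑' μ : adjointLattice (lattice A), (σ : Phase ι → ℂ) μ.1 *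
        conj ((τ : Phase ι → ℂ) μ.1)) := by
  have h := hasSum_integral_mul_chr_mul_conj σ τ (adjointLatticeEquiv A) (rotatedLatticeEquiv A)
    (inner_matrixEquiv _ _) (latticeVol_pos A) (by
      rw [← abs_det_sympMatrix]
      exact map_matrixEquiv_transpose_inv_volume _ (isUnit_det_sympMatrix A))
  rw [← (latticeEnum A).hasSum_iff, ← (adjointLatticeEnum A).tsum_eq]
  convert! h using 2 with n
  refine integral_congr_ae (Filter.Eventually.of_forall fun z => ?_)
  simp only
  -- Antisymmetry of `Ω` absorbs the minus sign of the Fourier character.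
  rw [inner_rotatedLatticeEquiv, ← symp_antisymm]
  rfl

end Lattice

section Operators

variable {ι : Type} [Fintype ι]

/-! ### Time-frequency shifts -/

lemma modulate_ae (w : Vec ι) (f : L2 ι) :
    modulate w f =ᵐ[volume] fun t => chr (inner ℝ w t) * f t :=
  MemLp.coeFn_toLp (memLp_modulate w (Lp.memLp f))

lemma translate_ae (x : Vec ι) (f : L2 ι) : translate x f =ᵐ[volume] fun t => f (t - x) :=
  Lp.coeFn_compMeasurePreserving f (measurePreserving_sub_right volume x)

lemma parity_ae (f : L2 ι) : parity ι f =ᵐ[volume] fun t => f (-t) :=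
  Lp.coeFn_compMeasurePreserving f (Measure.measurePreserving_neg volume)

lemma tfShift_ae (z : Phase ι) (f : L2 ι) :
    tfShift z f =ᵐ[volume] fun t => chr (inner ℝ (freq z) t) * f (t - pos z) := by
  filter_upwards [modulate_ae (freq z) (translate (pos z) f), translate_ae (pos z) f] with t h1 h2
  rw [← h2, ← h1]
  rfl

lemma norm_modulate (w : Vec ι) (f : L2 ι) : ‖modulate w f‖ = ‖f‖ := by
  apply le_antisymm <;> refine Lp.norm_le_norm_of_ae_le ?_ <;>
  · filter_upwards [modulate_ae w f] with t ht
    rw [ht, norm_mul, norm_chr, one_mul]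

lemma norm_translate (x : Vec ι) (f : L2 ι) : ‖translate x f‖ = ‖f‖ :=
  LinearIsometry.norm_map _ f

lemma norm_parity (f : L2 ι) : ‖parity ι f‖ = ‖f‖ := LinearIsometry.norm_map _ f

lemma norm_tfShift (z : Phase ι) (f : L2 ι) : ‖tfShift z f‖ = ‖f‖ := by
  change ‖modulate (freq z) (translate (pos z) f)‖ = ‖f‖
  rw [norm_modulate, norm_translate]

lemma inner_tfShift (z : Phase ι) (f g : L2 ι) :
    inner ℂ (tfShift z f) (tfShift z g) = inner ℂ f g :=
  LinearIsometry.inner_map_map (⟨(tfShift z).toLinearMap, norm_tfShift z⟩ : L2 ι →ₗᵢ[ℂ] L2 ι) f g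

lemma adjoint_tfShift_apply_tfShift (z : Phase ι) (f : L2 ι) :
    ContinuousLinearMap.adjoint (tfShift z) (tfShift z f) = f := by
  refine ext_inner_right ℂ fun g => ?_
  rw [ContinuousLinearMap.adjoint_inner_left, inner_tfShift]

lemma norm_tfShift_le (z : Phase ι) : ‖tfShift z‖ ≤ 1 :=
  ContinuousLinearMap.opNorm_le_bound _ zero_le_one fun f => by rw [norm_tfShift, one_mul]

lemma norm_parity_le : ‖parity ι‖ ≤ 1 :=
  ContinuousLinearMap.opNorm_le_bound _ zero_le_one fun f => by rw [norm_parity, one_mul]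

lemma tfShift_tfShift (z w : Phase ι) (f : L2 ι) :
    tfShift z (tfShift w f) = chr (-inner ℝ (pos z) (freq w)) • tfShift (z + w) f := by
  apply Lp.ext
  have h := (measurePreserving_sub_right volume (pos z)).quasiMeasurePreserving.ae
    (tfShift_ae w f)
  filter_upwards [tfShift_ae z (tfShift w f), h,
    Lp.coeFn_smul (chr (-inner ℝ (pos z) (freq w))) (tfShift (z + w) f), tfShift_ae (z + w) f]
    with t h1 h2 h3 h4
  rw [h1, h2, h3, Pi.smul_apply, h4, smul_eq_mul]
  have e1 : pos (z + w) = pos z + pos w := rfl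
  have e2 : freq (z + w) = freq z + freq w := rfl
  have e3 : inner ℝ (freq w) (t - pos z) = inner ℝ (freq w) t + -inner ℝ (pos z) (freq w) := by
    rw [inner_sub_right, real_inner_comm (freq w) (pos z), sub_eq_add_neg]
  rw [e1, e2, e3, inner_add_left, chr_add, chr_add, sub_sub]
  ring

lemma tfShift_zero (f : L2 ι) : tfShift (0 : Phase ι) f = f := by
  apply Lp.ext
  filter_upwards [tfShift_ae 0 f] with t ht
  have e1 : pos (0 : Phase ι) = 0 := rfl
  have e2 : freq (0 : Phase ι) = 0 := rfl
  rw [ht, e1, e2, inner_zero_left, chr_zero, one_mul, sub_zero]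

/-- Up to a phase, `π(-z)` is a right inverse of `π(z)`, and the adjoint of an isometry is a left
inverse. -/
lemma adjoint_tfShift (z : Phase ι) (f : L2 ι) :
    ContinuousLinearMap.adjoint (tfShift z) f =
      chr (-inner ℝ (pos z) (freq z)) • tfShift (-z) f := by
  have h := tfShift_tfShift z (-z) f
  have e : freq (-z) = -freq z := rfl
  rw [add_neg_cancel, tfShift_zero, e, inner_neg_right, neg_neg] at h
  have hf : f = chr (-inner ℝ (pos z) (freq z)) • tfShift z (tfShift (-z) f) := by
    rw [h, smul_smul, ← chr_add, neg_add_cancel, chr_zero, one_smul]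
  conv_lhs => rw [hf]
  rw [map_smul, adjoint_tfShift_apply_tfShift]

lemma parity_tfShift (z : Phase ι) (f : L2 ι) :
    parity ι (tfShift (-z) f) = tfShift z (parity ι f) := by
  apply Lp.ext
  have h := (Measure.measurePreserving_neg (volume : Measure (Vec ι))).quasiMeasurePreserving.ae
    (tfShift_ae (-z) f)
  have h' := (measurePreserving_sub_right volume (pos z)).quasiMeasurePreserving.ae (parity_ae f)
  filter_upwards [parity_ae (tfShift (-z) f), h, tfShift_ae z (parity ι f), h'] with t h1 h2 h3 h4
  rw [h1, h2, h3, h4]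
  have e1 : pos (-z) = -pos z := rfl
  have e2 : freq (-z) = -freq z := rfl
  rw [e1, e2, inner_neg_neg]
  congr 2
  abel

/-- Parity carries `π(-z)` to `π(z)`. The adjoint and the composition `π(z)π(z)` each contribute a
phase `e^{-2πi x·ω}`. This makes the two forms of the theorem equal term by term. -/
lemma opTranslate_parity (z : Phase ι) :
    opTranslate z (parity ι) =
      Complex.exp (-(4 * Real.pi * Complex.I * (inner ℝ (pos z) (freq z) : ℝ))) •
        (tfShift ((2 : ℝ) • z) ∘L parity ι) := by
  ext1 f
  change tfShift z (parity ι (ContinuousLinearMap.adjoint (tfShift z) f)) =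
    Complex.exp (-(4 * Real.pi * Complex.I * (inner ℝ (pos z) (freq z) : ℝ))) •
      tfShift ((2 : ℝ) • z) (parity ι f)
  rw [adjoint_tfShift, map_smul, map_smul, parity_tfShift, tfShift_tfShift, smul_smul, ← chr_add,
    two_smul]
  congr 1
  rw [chr]
  congr 1
  push_cast
  ring

/-! ### Symbols of the shifted parity operators -/

/-- The substitution `t = x + s/2` has Jacobian `2^{-d}` and produces the Wigner integral; the phase
`e^{4πi x·ω}` of the modulation cancels the prefactor. -/
lemma matrixCoeff_tfShift_parity (z : Phase ι) (f g : SchwartzMap (Vec ι) ℂ) :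
    Complex.exp (-(4 * Real.pi * Complex.I * (inner ℝ (pos z) (freq z) : ℝ))) *
      matrixCoeff (tfShift ((2 : ℝ) • z) ∘L parity ι) f g =
      ((2 : ℂ) ^ Fintype.card ι)⁻¹ * conj (wigner g f z) := by
  have h1 : matrixCoeff (tfShift ((2 : ℝ) • z) ∘L parity ι) f g =
      ∫ t : Vec ι, chr (inner ℝ ((2 : ℝ) • freq z) t) * f (-(t - (2 : ℝ) • pos z)) *
        conj (g t) := by
    unfold matrixCoeff
    rw [L2.inner_def]
    have h0 := (measurePreserving_sub_right volume ((2 : ℝ) • pos z)).quasiMeasurePreserving.ae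
      (parity_ae (f.toLp 2 volume))
    have h0' := ((Measure.measurePreserving_neg (volume : Measure (Vec ι))).comp
      (measurePreserving_sub_right volume ((2 : ℝ) • pos z))).quasiMeasurePreserving.ae
      (f.coeFn_toLp 2 volume)
    refine integral_congr_ae ?_
    filter_upwards [g.coeFn_toLp 2 volume, tfShift_ae ((2 : ℝ) • z) (parity ι (f.toLp 2 volume)),
      h0, h0'] with t h2 h3 h4 h5
    rw [ContinuousLinearMap.comp_apply, h2, h3, RCLike.inner_apply]
    have e1 : pos ((2 : ℝ) • z) = (2 : ℝ) • pos z := rfl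
    have e2 : freq ((2 : ℝ) • z) = (2 : ℝ) • freq z := rfl
    have h5' : (f.toLp 2 volume : L2 ι) (-(t - (2 : ℝ) • pos z)) = f (-(t - (2 : ℝ) • pos z)) := h5
    rw [e1, e2, h4, h5']
  have h2 : ∫ t : Vec ι, chr (inner ℝ ((2 : ℝ) • freq z) t) * f (-(t - (2 : ℝ) • pos z)) *
      conj (g t) = ((2 : ℂ) ^ Fintype.card ι)⁻¹ * ∫ s : Vec ι,
        chr (inner ℝ ((2 : ℝ) • freq z) (pos z + (1 / 2 : ℝ) • s)) *
        f (-(pos z + (1 / 2 : ℝ) • s - (2 : ℝ) • pos z)) * conj (g (pos z + (1 / 2 : ℝ) • s)) := by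
    rw [Measure.integral_comp_smul volume (fun s : Vec ι =>
      chr (inner ℝ ((2 : ℝ) • freq z) (pos z + s)) *
        f (-(pos z + s - (2 : ℝ) • pos z)) * conj (g (pos z + s))) (1 / 2 : ℝ),
      integral_add_left_eq_self (fun t : Vec ι => chr (inner ℝ ((2 : ℝ) • freq z) t) *
        f (-(t - (2 : ℝ) • pos z)) * conj (g t)) (pos z), finrank_euclideanSpace,
      Complex.real_smul, ← mul_assoc]
    have : ((2 : ℂ) ^ Fintype.card ι)⁻¹ *
        ((|((1 / 2 : ℝ) ^ Fintype.card ι)⁻¹| : ℝ) : ℂ) = 1 := by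
      rw [abs_of_pos (by positivity)]
      push_cast
      rw [one_div, inv_pow, inv_inv, inv_mul_cancel₀ (pow_ne_zero _ two_ne_zero)]
    rw [this, one_mul]
  rw [h1, h2, mul_left_comm]
  congr 1
  unfold wigner
  rw [← integral_conj, ← integral_const_mul]
  refine integral_congr_ae (Filter.Eventually.of_forall fun s => ?_)
  simp only [map_mul, Complex.conj_conj, conj_chr, neg_neg]
  have e1 : -(pos z + (1 / 2 : ℝ) • s - (2 : ℝ) • pos z) = pos z - (1 / 2 : ℝ) • s := by module
  have e2 : inner ℝ ((2 : ℝ) • freq z) (pos z + (1 / 2 : ℝ) • s) =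
      2 * inner ℝ (pos z) (freq z) + inner ℝ (freq z) s := by
    rw [inner_add_right, real_inner_smul_left, real_inner_smul_left, real_inner_smul_right,
      real_inner_comm (pos z)]
    ring
  have e3 : Complex.exp (-(4 * Real.pi * Complex.I * (inner ℝ (pos z) (freq z) : ℝ))) *
      chr (2 * inner ℝ (pos z) (freq z)) = 1 := by
    rw [chr, ← Complex.exp_add, Complex.exp_eq_one_iff]
    exact ⟨0, by push_cast; ring⟩
  rw [e1, e2, chr_add]
  linear_combination (chr (inner ℝ (freq z) s) * f (pos z - (1 / 2 : ℝ) • s) *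
    conj (g (pos z + (1 / 2 : ℝ) • s))) * e3

/-! ### Time-frequency shifts of Schwartz functions -/

lemma iteratedDeriv_chr (n : ℕ) :
    iteratedDeriv n chr = fun s => (2 * Real.pi * Complex.I) ^ n * chr s := by
  induction n with
  | zero => simp
  | succ n ih =>
    rw [iteratedDeriv_succ, ih]
    funext s
    have h1 : HasDerivAt (fun s : ℝ => 2 * Real.pi * Complex.I * (s : ℂ))
        (2 * Real.pi * Complex.I) s := by
      simpa using (Complex.ofRealCLM.hasDerivAt (x := s)).const_mul (2 * Real.pi * Complex.I)
    have h2 : HasDerivAt chr (chr s * (2 * Real.pi * Complex.I)) s := h1.cexp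
    rw [(h2.const_mul _).deriv]
    ring

lemma hasTemperateGrowth_chr : Function.HasTemperateGrowth chr := by
  refine ⟨?_, fun n => ⟨0, ‖(2 * Real.pi * Complex.I : ℂ) ^ n‖, fun s => ?_⟩⟩
  · unfold chr
    exact ((contDiff_const.mul Complex.ofRealCLM.contDiff).cexp)
  · rw [norm_iteratedFDeriv_eq_norm_iteratedDeriv, iteratedDeriv_chr, norm_mul, norm_chr]
    simp

lemma hasTemperateGrowth_chr_inner (w : Vec ι) :
    Function.HasTemperateGrowth fun t : Vec ι => chr (inner ℝ w t) :=
  hasTemperateGrowth_chr.comp (by fun_prop)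

/-- The time-frequency shift of a Schwartz function. -/
def schwartzShift (z : Phase ι) (f : SchwartzMap (Vec ι) ℂ) : SchwartzMap (Vec ι) ℂ :=
  SchwartzMap.smulLeftCLM ℂ (fun t => chr (inner ℝ (freq z) t))
    (SchwartzMap.compSubConstCLM ℂ (pos z) f)

lemma schwartzShift_apply (z : Phase ι) (f : SchwartzMap (Vec ι) ℂ) (t : Vec ι) :
    schwartzShift z f t = chr (inner ℝ (freq z) t) * f (t - pos z) := by
  rw [schwartzShift, SchwartzMap.smulLeftCLM_apply_apply (hasTemperateGrowth_chr_inner _)]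
  rfl

/-- The inverse time-frequency shift of a Schwartz function. -/
def schwartzUnshift (z : Phase ι) (f : SchwartzMap (Vec ι) ℂ) : SchwartzMap (Vec ι) ℂ :=
  SchwartzMap.compSubConstCLM ℂ (-pos z)
    (SchwartzMap.smulLeftCLM ℂ (fun t => chr (inner ℝ (-freq z) t)) f)

lemma schwartzUnshift_apply (z : Phase ι) (f : SchwartzMap (Vec ι) ℂ) (t : Vec ι) :
    schwartzUnshift z f t = chr (inner ℝ (-freq z) (t + pos z)) * f (t + pos z) := by
  rw [schwartzUnshift, SchwartzMap.compSubConstCLM_apply,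
    SchwartzMap.smulLeftCLM_apply_apply (hasTemperateGrowth_chr_inner _), sub_neg_eq_add]
  rfl

lemma schwartzShift_unshift (z : Phase ι) (f : SchwartzMap (Vec ι) ℂ) :
    schwartzShift z (schwartzUnshift z f) = f := by
  ext t
  rw [schwartzShift_apply, schwartzUnshift_apply, ← mul_assoc, ← chr_add, sub_add_cancel,
    inner_neg_left, add_neg_cancel, chr_zero, one_mul]

lemma tfShift_toLp (z : Phase ι) (f : SchwartzMap (Vec ι) ℂ) :
    tfShift z (f.toLp 2 volume) = (schwartzShift z f).toLp 2 volume := by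
  apply Lp.ext
  have h := (measurePreserving_sub_right volume (pos z)).quasiMeasurePreserving.ae
    (f.coeFn_toLp 2 volume)
  filter_upwards [tfShift_ae z (f.toLp 2 volume), h, (schwartzShift z f).coeFn_toLp 2 volume]
    with t h1 h2 h3
  rw [h1, h2, h3, schwartzShift_apply]

/-! ### Operator modulation on the level of Weyl symbols -/

lemma matrixCoeff_opModulate (w : Phase ι) (S : L2 ι →L[ℂ] L2 ι) (f g : SchwartzMap (Vec ι) ℂ) :
    matrixCoeff (opModulate w S) f g =
      Complex.exp (-(Real.pi * Complex.I * (inner ℝ (pos w) (freq w) : ℝ) / 2)) *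
        matrixCoeff S (schwartzShift ((1 / 2 : ℝ) • w) f)
          (schwartzUnshift ((1 / 2 : ℝ) • w) g) := by
  unfold matrixCoeff opModulate
  rw [smul_apply, inner_smul_right, ContinuousLinearMap.comp_apply,
    ContinuousLinearMap.comp_apply, tfShift_toLp]
  congr 1
  conv_lhs => rw [← schwartzShift_unshift ((1 / 2 : ℝ) • w) g, ← tfShift_toLp]
  rw [inner_tfShift]

/-- Operator modulation multiplies the Weyl symbol by a symplectic character. -/
lemma conj_wigner_shift (w z : Phase ι) (f g : SchwartzMap (Vec ι) ℂ) :
    Complex.exp (-(Real.pi * Complex.I * (inner ℝ (pos w) (freq w) : ℝ) / 2)) *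
      conj (wigner (schwartzUnshift ((1 / 2 : ℝ) • w) g) (schwartzShift ((1 / 2 : ℝ) • w) f) z) =
      chr (symp w z) * conj (wigner g f z) := by
  have e1 : pos ((1 / 2 : ℝ) • w) = (1 / 2 : ℝ) • pos w := rfl
  have e2 : freq ((1 / 2 : ℝ) • w) = (1 / 2 : ℝ) • freq w := rfl
  unfold wigner
  -- Both half-shifts by `w/2` act on the arguments like a translation of the integration variable
  -- by `w₁`; undoing it leaves only phases to compare.
  rw [← integral_add_right_eq_self _ (-pos w), ← integral_conj, ← integral_conj,
    ← integral_const_mul, ← integral_const_mul]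
  refine integral_congr_ae (Filter.Eventually.of_forall fun s => ?_)
  simp only [schwartzShift_apply, schwartzUnshift_apply, e1, e2, map_mul, Complex.conj_conj,
    conj_chr, neg_neg]
  have p1 : pos z + (1 / 2 : ℝ) • (s + -pos w) + (1 / 2 : ℝ) • pos w =
      pos z + (1 / 2 : ℝ) • s := by module
  have p2 : pos z - (1 / 2 : ℝ) • (s + -pos w) - (1 / 2 : ℝ) • pos w =
      pos z - (1 / 2 : ℝ) • s := by module
  rw [p1, p2]
  have hexp : Complex.exp (-(Real.pi * Complex.I * (inner ℝ (pos w) (freq w) : ℝ) / 2)) =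
      chr (-(inner ℝ (pos w) (freq w) / 4)) := by
    rw [chr]
    congr 1
    push_cast
    ring
  rw [hexp]
  have hph : -(inner ℝ (pos w) (freq w) / 4) +
      (-inner ℝ (-((1 / 2 : ℝ) • freq w)) (pos z + (1 / 2 : ℝ) • s) +
        (inner ℝ ((1 / 2 : ℝ) • freq w) (pos z - (1 / 2 : ℝ) • (s + -pos w)) +
        inner ℝ (freq z) (s + -pos w))) = symp w z + inner ℝ (freq z) s := by
    simp only [symp, inner_add_right, inner_sub_right, inner_neg_left, inner_neg_right,
      real_inner_smul_left, real_inner_smul_right]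
    rw [real_inner_comm (freq w) (pos w), real_inner_comm (freq w) (pos z),
      real_inner_comm (pos w) (freq z)]
    ring
  have hchr := congrArg chr hph
  simp only [chr_add] at hchr
  linear_combination (conj (g (pos z + (1 / 2 : ℝ) • s)) * f (pos z - (1 / 2 : ℝ) • s)) * hchr

lemma matrixCoeff_opModulate_eq_integral {S : L2 ι →L[ℂ] L2 ι} {σ : M1 (ι ⊕ ι)}
    (hσ : HasWeylSymbolM1 S σ) (w : Phase ι) (f g : SchwartzMap (Vec ι) ℂ) :
    matrixCoeff (opModulate w S) f g =
      ∫ z : Phase ι, (σ : Phase ι → ℂ) z * chr (symp w z) * conj (wigner g f z) := by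
  rw [matrixCoeff_opModulate, hσ, ← integral_const_mul]
  refine integral_congr_ae (Filter.Eventually.of_forall fun z => ?_)
  simp only
  linear_combination (σ : Phase ι → ℂ) z * conj_wigner_shift w z f g

/-! ### Functionals on `M¹` -/

section Functionals

variable {κ : Type} [Fintype κ]

lemma integrable_mul_conj {F : Vec κ → ℂ} (hF : Integrable F) (τ : M1 κ) :
    Integrable fun z => F z * conj ((τ : Vec κ → ℂ) z) :=
  hF.mul_bdd (c := gaussMax κ * M1norm τ)
    (Complex.continuous_conj.comp (M1.continuous τ)).aestronglyMeasurable
    (Filter.Eventually.of_forall fun t => by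
      rw [RCLike.norm_conj]
      exact M1.norm_le τ t)

/-- An integrable function as an element of `M^∞`. -/
def MInfty.ofIntegrable (F : Vec κ → ℂ) (hF : Integrable F) : MInfty κ :=
  ⟨{ toFun := fun τ => ∫ z, F z * conj ((τ : Vec κ → ℂ) z)
     map_add' := fun τ τ' => by
      rw [← integral_add (integrable_mul_conj hF τ) (integrable_mul_conj hF τ')]
      refine integral_congr_ae (Filter.Eventually.of_forall fun z => ?_)
      simp [mul_add]
     map_smul' := fun c τ => by
      rw [smul_eq_mul, ← integral_const_mul]
      refine integral_congr_ae (Filter.Eventually.of_forall fun z => ?_)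
      simp only [Submodule.coe_smul, Pi.smul_apply, smul_eq_mul, map_mul]
      ring },
    (∫ z, ‖F z‖) * gaussMax κ, fun τ => by
      refine (norm_integral_le_integral_norm _).trans ?_
      rw [mul_assoc, ← integral_mul_const]
      refine integral_mono (integrable_mul_conj hF τ).norm (hF.norm.mul_const _) fun z => ?_
      simp only [norm_mul, RCLike.norm_conj]
      exact mul_le_mul_of_nonneg_left (M1.norm_le τ z) (norm_nonneg _)⟩

lemma summable_mul_conj {N : Type} {a : N → ℂ} (ha : Summable fun n => ‖a n‖) (p : N → Vec κ)
    (τ : M1 κ) : Summable fun n => ‖a n * conj ((τ : Vec κ → ℂ) (p n))‖ :=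
  Summable.of_nonneg_of_le (fun _ => norm_nonneg _) (fun n => by
    rw [norm_mul, RCLike.norm_conj]
    exact mul_le_mul_of_nonneg_left (M1.norm_le τ _) (norm_nonneg _))
    (ha.mul_right (gaussMax κ * M1norm τ))

/-- A summable combination of point masses as an element of `M^∞`. -/
def MInfty.ofPoints {N : Type} (a : N → ℂ) (ha : Summable fun n => ‖a n‖) (p : N → Vec κ) :
    MInfty κ :=
  ⟨{ toFun := fun τ => ∑' n, a n * conj ((τ : Vec κ → ℂ) (p n))
     map_add' := fun τ τ' => by
      rw [← (summable_mul_conj ha p τ).of_norm.tsum_add (summable_mul_conj ha p τ').of_norm]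
      refine tsum_congr fun n => ?_
      simp [mul_add]
     map_smul' := fun c τ => by
      rw [smul_eq_mul, ← tsum_mul_left]
      refine tsum_congr fun n => ?_
      simp only [Submodule.coe_smul, Pi.smul_apply, smul_eq_mul, map_mul]
      ring },
    (∑' n, ‖a n‖) * gaussMax κ, fun τ => by
      refine (norm_tsum_le_tsum_norm (summable_mul_conj ha p τ)).trans ?_
      rw [mul_assoc, ← tsum_mul_right]
      refine (summable_mul_conj ha p τ).tsum_le_tsum (fun n => ?_) (ha.mul_right _)
      rw [norm_mul, RCLike.norm_conj]
      exact mul_le_mul_of_nonneg_left (M1.norm_le τ _) (norm_nonneg _)⟩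

end Functionals

/-! ### Convergence of the parity series and assembly of the representation -/

lemma integrable_mul_chr_symp (σ : M1 (ι ⊕ ι)) (w : Phase ι) :
    Integrable fun z : Phase ι => (σ : Phase ι → ℂ) z * chr (symp w z) :=
  (M1.integrable σ).mul_bdd (c := 1)
    (continuous_chr.comp (by unfold symp; fun_prop)).aestronglyMeasurable
    (Filter.Eventually.of_forall fun z => (norm_chr _).le)

/-- The map `T ↦ ⟨T f, g⟩` as a continuous linear functional. -/
def matrixCoeffCLM (f g : SchwartzMap (Vec ι) ℂ) : (L2 ι →L[ℂ] L2 ι) →L[ℂ] ℂ :=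
  (innerSL ℂ (g.toLp 2 volume : L2 ι)) ∘L
    (ContinuousLinearMap.apply ℂ (L2 ι) (f.toLp 2 volume : L2 ι))

lemma matrixCoeffCLM_apply (f g : SchwartzMap (Vec ι) ℂ) (T : L2 ι →L[ℂ] L2 ι) :
    matrixCoeffCLM f g T = matrixCoeff T f g := rfl

lemma norm_exp_inner (z : Phase ι) :
    ‖Complex.exp (-(4 * Real.pi * Complex.I * (inner ℝ (pos z) (freq z) : ℝ)))‖ = 1 := by
  rw [show (-(4 * Real.pi * Complex.I * (inner ℝ (pos z) (freq z) : ℝ)) : ℂ) =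
    ((-(4 * Real.pi * inner ℝ (pos z) (freq z)) : ℝ) : ℂ) * Complex.I by push_cast; ring]
  exact Complex.norm_exp_ofReal_mul_I _

lemma summable_norm_tfShift_parity {N : Type} {a : N → ℂ} (ha : Summable fun n => ‖a n‖)
    (p : N → Phase ι) : Summable fun n =>
      ‖(a n * Complex.exp (-(4 * Real.pi * Complex.I *
        (inner ℝ (pos (p n)) (freq (p n)) : ℝ)))) • (tfShift ((2 : ℝ) • p n) ∘L parity ι)‖ := by
  refine Summable.of_nonneg_of_le (fun _ => norm_nonneg _) (fun n => ?_) ha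
  rw [norm_smul, norm_mul, norm_exp_inner, mul_one]
  refine mul_le_of_le_one_right (norm_nonneg _) ?_
  exact (ContinuousLinearMap.opNorm_comp_le _ _).trans
    (mul_le_one₀ (norm_tfShift_le _) (norm_nonneg _) norm_parity_le)

lemma matrixCoeff_tsum_tfShift_parity {N : Type} {a : N → ℂ} (ha : Summable fun n => ‖a n‖)
    (p : N → Phase ι) (f g : SchwartzMap (Vec ι) ℂ) :
    matrixCoeff (∑' n, (a n * Complex.exp (-(4 * Real.pi * Complex.I *
        (inner ℝ (pos (p n)) (freq (p n)) : ℝ)))) • (tfShift ((2 : ℝ) • p n) ∘L parity ι)) f g =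
      ((2 : ℂ) ^ Fintype.card ι)⁻¹ * ∑' n, a n * conj (wigner g f (p n)) := by
  rw [← matrixCoeffCLM_apply,
    ContinuousLinearMap.map_tsum _ (summable_norm_tfShift_parity ha p).of_norm, ← tsum_mul_left]
  refine tsum_congr fun n => ?_
  rw [map_smul, matrixCoeffCLM_apply, smul_eq_mul, mul_assoc, matrixCoeff_tfShift_parity]
  ring

lemma smul_opTranslate_parity (a : ℂ) (z : Phase ι) :
    a • opTranslate z (parity ι) =
      (a * Complex.exp (-(4 * Real.pi * Complex.I * (inner ℝ (pos z) (freq z) : ℝ)))) •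
        (tfShift ((2 : ℝ) • z) ∘L parity ι) := by
  rw [opTranslate_parity, smul_smul]

/-- The Janssen-type representation of a lattice sum of operator modulations. -/
theorem weakStarHasSum_opModulate [DecidableEq ι] (A : Matrix.GeneralLinearGroup (ι ⊕ ι) ℝ)
    {S : L2 ι →L[ℂ] L2 ι} {σ : M1 (ι ⊕ ι)} (hσ : HasWeylSymbolM1 S σ) :
    WeakStarHasSum (fun l : lattice A => opModulate l.1 S)
      (((2 : ℂ) ^ Fintype.card ι / (latticeVol A : ℂ)) •
        ∑' μ : adjointLattice (lattice A),
          ((σ : Phase ι → ℂ) μ.1 * Complex.exp (-(4 * Real.pi * Complex.I *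
              (inner ℝ (pos μ.1) (freq μ.1) : ℝ)))) •
            (tfShift ((2 : ℝ) • μ.1) ∘L parity ι)) := by
  have hsum := summable_norm_adjointLattice A σ
  have hsum' : Summable fun μ : adjointLattice (lattice A) =>
      ‖(latticeVol A : ℂ)⁻¹ * (σ : Phase ι → ℂ) μ.1‖ := by
    simp only [norm_mul]
    exact hsum.mul_left _
  -- The symbols are `σ` times a character for each `β_λ(S)`, and point masses on `Λ°` with weights
  -- `|Λ|⁻¹ σ(λ°)` for the right-hand side.
  refine ⟨fun l => MInfty.ofIntegrable _ (integrable_mul_chr_symp σ l.1),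
    MInfty.ofPoints _ hsum' fun μ => μ.1, fun l f g τ hτ => ?_, fun f g τ hτ => ?_, fun τ => ?_⟩
  · rw [matrixCoeff_opModulate_eq_integral hσ, ← hτ]
    rfl
  · rw [← matrixCoeffCLM_apply, map_smul, matrixCoeffCLM_apply,
      matrixCoeff_tsum_tfShift_parity hsum (fun μ => μ.1), ← hτ, smul_eq_mul, ← mul_assoc]
    change _ = ∑' μ : adjointLattice (lattice A), (latticeVol A : ℂ)⁻¹ *
      (σ : Phase ι → ℂ) μ.1 * conj ((τ : Phase ι → ℂ) μ.1)
    simp only [mul_assoc]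
    rw [tsum_mul_left]
    field_simp
  · change HasSum (fun l : lattice A => ∫ z : Phase ι, (σ : Phase ι → ℂ) z * chr (symp l.1 z) *
      conj ((τ : Phase ι → ℂ) z)) (∑' μ : adjointLattice (lattice A), (latticeVol A : ℂ)⁻¹ *
      (σ : Phase ι → ℂ) μ.1 * conj ((τ : Phase ι → ℂ) μ.1))
    simp only [mul_assoc _ _ (conj ((τ : Phase ι → ℂ) _)), tsum_mul_left]
    simpa only [mul_assoc] using hasSum_lattice_integral A σ τ

end Operators

end JanssenRep

end

theorem theorem5 (d : ℕ) (A : Matrix.GeneralLinearGroup (Fin d ⊕ Fin d) ℝ)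
    (S : JanssenRep.L2 (Fin d) →L[ℂ] JanssenRep.L2 (Fin d))
    (σ : JanssenRep.M1 (Fin d ⊕ Fin d)) (hσ : JanssenRep.HasWeylSymbolM1 S σ) :
    -- the coefficients and both series on the right-hand side converge absolutely
    Summable (fun μ : JanssenRep.adjointLattice (JanssenRep.lattice A) => ‖σ.1 μ.1‖) ∧
    Summable (fun μ : JanssenRep.adjointLattice (JanssenRep.lattice A) =>
      ‖(σ.1 μ.1 * Complex.exp (-(4 * Real.pi * Complex.I *
          (inner ℝ (JanssenRep.pos μ.1) (JanssenRep.freq μ.1) : ℝ)))) •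
        (JanssenRep.tfShift ((2 : ℝ) • μ.1) ∘L JanssenRep.parity (Fin d))‖) ∧
    Summable (fun μ : JanssenRep.adjointLattice (JanssenRep.lattice A) =>
      ‖σ.1 μ.1 • JanssenRep.opTranslate μ.1 (JanssenRep.parity (Fin d))‖) ∧
    -- the representation through time-frequency shifts
    JanssenRep.WeakStarHasSum
      (fun l : JanssenRep.lattice A => JanssenRep.opModulate l.1 S)
      (((2 : ℂ) ^ d / (JanssenRep.latticeVol A : ℂ)) •
        ∑' μ : JanssenRep.adjointLattice (JanssenRep.lattice A),
          (σ.1 μ.1 * Complex.exp (-(4 * Real.pi * Complex.I *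
              (inner ℝ (JanssenRep.pos μ.1) (JanssenRep.freq μ.1) : ℝ)))) •
            (JanssenRep.tfShift ((2 : ℝ) • μ.1) ∘L JanssenRep.parity (Fin d))) ∧
    -- the representation through translates of the parity operator
    JanssenRep.WeakStarHasSum
      (fun l : JanssenRep.lattice A => JanssenRep.opModulate l.1 S)
      (((2 : ℂ) ^ d / (JanssenRep.latticeVol A : ℂ)) •
        ∑' μ : JanssenRep.adjointLattice (JanssenRep.lattice A),
          σ.1 μ.1 • JanssenRep.opTranslate μ.1 (JanssenRep.parity (Fin d))) := by
  have hsum := JanssenRep.summable_norm_adjointLattice A σ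
  have hshift := JanssenRep.summable_norm_tfShift_parity hsum fun μ => μ.1
  have hweak := JanssenRep.weakStarHasSum_opModulate A hσ
  rw [Fintype.card_fin] at hweak
  simp only [JanssenRep.smul_opTranslate_parity]
  exact ⟨hsum, hshift, hshift, hweak, hweak⟩
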